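/- Let $\mathbb{F}$ be an infinite field, let $n\ge 1$, and let $\mathrm{UT}_n$ be the algebra of upper triangular $n\times n$ matrices over $\mathbb{F}$. Let $\ast$ be an involution on $\mathrm{UT}_n$, that is, an $\mathbb{F}$-linear map $\mathrm{UT}_n\to\mathrm{UT}_n$ with $(ab)^\ast=b^\ast a^\ast$ and $(a^\ast)^\ast=a$ for all $a,b$. Let $\mathbb{F}\langle X,\ast\rangle$ be the free associative algebra with involution on $X=\{x_1,x_2,\ldots\}$ (the free associative algebra on the letters $x_i,x_i^\ast$), let $\mathrm{Id}(\mathrm{UT}_n,\ast)$ be the set of $\ast$-polynomial identities of $(\mathrm{UT}_n,\ast)$, i.e. of those $f\in\mathbb{F}\langle X,\ast\rangle$ that vanish whenever each $x_i$ is replaced by some $a_i\in\mathrm{UT}_n$ and each $x_i^\ast$ by $a_i^\ast$, and let $P_m^{(\ast)}$ be the span of the monomials $x_{\sigma(1)}^{\delta_1}\cdots x_{\sigma(m)}^{\delta_m}$ with $\sigma\in\mathcal{S}_m$ and $\delta_\ell\in\{\emptyset,\ast\}$. Then the $\ast$-codimension sequence $$c_m(\mathrm{UT}_n,\ast)=\dim_{\mathbb{F}}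 P_m^{(\ast)}/\bigl(P_m^{(\ast)}\cap\mathrm{Id}(\mathrm{UT}_n,\ast)\bigr)$$ satisfies $$c_m(\mathrm{UT}_n,\ast)\sim\frac{2^{\lfloor\frac{n-1}{2}\rfloor}}{n^{n-1}}\,m^{n-1}n^m\qquad(m\to\infty),$$ that is, the quotient of the two sides tends to $1$ as $m\to\infty$. -/

import Mathlib

open Filter Topology

noncomputable section

/-- An involution (of the first kind) on an associative `F`-algebra `A`: an `F`-linear map
`∗ : A → A` with `(ab)∗ = b∗ a∗` and `(a∗)∗ = a`. -/
structure AlgInvolution (F A : Type*) [Field F] [Ring A] [Algebra F A] extends A →ₗ[F] A where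
  map_mul' : ∀ a b : A, toFun (a * b) = toFun b * toFun a
  involutive' : ∀ a : A, toFun (toFun a) = a

/-- The algebra `UT_n` of upper triangular `n × n` matrices over `F`. -/
abbrev UT (F : Type*) [Field F] (n : ℕ) : Subalgebra F (Matrix (Fin n) (Fin n) F) :=
  Matrix.blockTriangularSubalgebra F F (id : Fin n → Fin n)

/-- The free associative algebra with involution on the variables `x_0, x_1, x_2, …`, realised as
the free associative algebra on the letters `x_i` (the pair `(i, false)`) and `x_i∗`
(the pair `(i, true)`). Its involution is `freeInvolution`. -/
abbrev FreeStarAlg (F : Type*) [Field F] : Type _ := FreeAlgebra F (ℕ × Bool)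

/-- The anti-endomorphism of the free algebra which interchanges `x_i` and `x_i∗`, as a
homomorphism to the opposite algebra. -/
def freeStarHom (F : Type*) [Field F] : FreeStarAlg F →ₐ[F] (FreeStarAlg F)ᵐᵒᵖ :=
  FreeAlgebra.lift F fun p => MulOpposite.op (FreeAlgebra.ι F (p.1, !p.2))

/-- The involution of the free algebra with involution: it interchanges `x_i` and `x_i∗` and
reverses products. -/
def freeInvolution (F : Type*) [Field F] : AlgInvolution F (FreeStarAlg F) where
  toFun f := (freeStarHom F f).unop
  map_add' f g := by simp
  map_smul' r f := by simp
  map_mul' f g := by simp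
  involutive' f := by
    induction f using FreeAlgebra.induction with
    | grade0 r => simp [MulOpposite.algebraMap_apply]
    | grade1 p => simp [freeStarHom]
    | mul a b ha hb => simp [ha, hb]
    | add a b ha hb => simp [ha, hb]

/-- The letter `x_i` (for `d = false`) or `x_i∗` (for `d = true`) of the free algebra with
involution. -/
def starVar (F : Type*) [Field F] (i : ℕ) (d : Bool) : FreeStarAlg F :=
  bif d then (freeInvolution F).toLinearMap (FreeAlgebra.ι F (i, false))
  else FreeAlgebra.ι F (i, false)

/-- The evaluation `f ↦ f(a_0, a_0∗, a_1, a_1∗, …)` of ∗-polynomials in an algebra with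
involution. -/
def starEval {F A : Type*} [Field F] [Ring A] [Algebra F A] (σ : AlgInvolution F A)
    (a : ℕ → A) : FreeStarAlg F →ₐ[F] A :=
  FreeAlgebra.lift F fun p => bif p.2 then σ.toLinearMap (a p.1) else a p.1

/-- `starEval σ a` commutes with the involutions; it is thus the homomorphism of algebras with
involution which sends `x_i` to `a i`. -/
theorem starEval_freeInvolution {F A : Type*} [Field F] [Ring A] [Algebra F A]
    (σ : AlgInvolution F A) (a : ℕ → A) (f : FreeStarAlg F) :
    starEval σ a ((freeInvolution F).toLinearMap f) = σ.toLinearMap (starEval σ a f) := by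
  have hmul : ∀ x y : A, σ.toLinearMap (x * y) = σ.toLinearMap y * σ.toLinearMap x := σ.map_mul'
  have hinv : ∀ x : A, σ.toLinearMap (σ.toLinearMap x) = x := σ.involutive'
  have hone : σ.toLinearMap 1 = 1 := by
    have h := hmul (σ.toLinearMap 1) 1
    rw [mul_one, hinv, mul_one] at h
    exact h.symm
  induction f using FreeAlgebra.induction with
  | grade0 r =>
    have h : (freeInvolution F).toLinearMap (algebraMap F (FreeStarAlg F) r)
        = algebraMap F (FreeStarAlg F) r := by
      simp [freeInvolution, MulOpposite.algebraMap_apply]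
    rw [h, AlgHom.commutes, Algebra.algebraMap_eq_smul_one, map_smul, hone]
  | grade1 p =>
    obtain ⟨i, d⟩ := p
    cases d <;> simp [freeInvolution, freeStarHom, starEval, hinv]
  | mul f g hf hg =>
    have h : (freeInvolution F).toLinearMap (f * g)
        = (freeInvolution F).toLinearMap g * (freeInvolution F).toLinearMap f :=
      (freeInvolution F).map_mul' f g
    rw [h, map_mul, map_mul, hmul, hf, hg]
  | add f g hf hg => rw [map_add, map_add, map_add, map_add, hf, hg]

/-- `Id(A, ∗)`: the space of all ∗-polynomial identities of `(A, ∗)`. -/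
def starIdentities {F A : Type*} [Field F] [Ring A] [Algebra F A] (σ : AlgInvolution F A) :
    Submodule F (FreeStarAlg F) where
  carrier := {f | ∀ a : ℕ → A, starEval σ a f = 0}
  zero_mem' := by simp
  add_mem' hf hg a := by simp [hf a, hg a]
  smul_mem' r f hf a := by simp [hf a]

/-- The space of multilinear ∗-polynomials in `m` variables: the span of all the monomials
`x_{s(1)}^{δ_1} ⋯ x_{s(m)}^{δ_m}` where `s` is a permutation and each `δ_k` is `∅` or `∗`. -/
def multilinearStar (F : Type*) [Field F] (m : ℕ) : Submodule F (FreeStarAlg F) :=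
  Submodule.span F (Set.range fun p : Equiv.Perm (Fin m) × (Fin m → Bool) =>
    (List.ofFn fun k : Fin m => starVar F (p.1 k) (p.2 k)).prod)

/-- The ∗-codimension `c_m(A, ∗) = dim P_m / (P_m ∩ Id(A, ∗))`. -/
def starCodim {F A : Type*} [Field F] [Ring A] [Algebra F A] (σ : AlgInvolution F A)
    (m : ℕ) : ℕ :=
  Module.finrank F
    (multilinearStar F m ⧸ (starIdentities σ).submoduleOf (multilinearStar F m))

end

/-! Write `n = N + 1`. The codimension is the dimension of the space of functions that the
multilinear words define on matrices, so the task is to count independent monomials in matrix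
entries. About the involution only two facts are needed: it reverses the diagonal
(`involution_diag`), and it reverses the superdiagonal up to nonzero scalars and diagonal entries
(`exists_involution_superdiag`).

Upper bound (`starCodim_le`): an entry of a word is a sum over monotone paths in `{0, …, N}`, and
each step is expanded in the entries of its letter. A step that stays in place contributes only
diagonal entries, so a term has at most `N` off-diagonal factors. There are only `O(m ^ (N - 1) * n
^ m)` monomials with fewer than `N`. Having `N` of them forces the path `0 → 1 → ⋯ → N`, hence the
corner entry, and the letter at step `e` is read at the superdiagonal position `e` or, through `∗`,
at `e.rev`. The injective choices of letters number about `m ^ N`, and the other letters have `n ^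
(m - N)` diagonal labellings. For a mirror pair `{e, e.rev}`, two given letters have four
labellings, of which the two orders of the letters account for only two; this is one further factor
2 per pair, and none for a middle position.

Lower bound (`le_starCodim`): reserve `r` letters with surjective diagonal labels. Every dominant
labelling of the other letters is then separated from all the others by a product of `N` iterated
commutators (`eval_poly_ne_zero_iff`). For fixed `r` this yields a lower limit of at least `1 - n *
(N / n) ^ r` for the quotient, and `r` is arbitrary. -/

noncomputable section

/-! ### Matrix entries and the characters of the upper triangular algebra. -/

namespace UT

variable {F : Type*} [Field F] {n : ℕ}

/-- The coordinate functional `x ↦ x p q`. -/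
def ent (p q : Fin n) : UT F n →ₗ[F] F where
  toFun x := x.1 p q
  map_add' _ _ := rfl
  map_smul' _ _ := rfl

theorem ent_of_lt {p q : Fin n} (h : q < p) (x : UT F n) : ent p q x = 0 := x.2 h

theorem ext_ent {x y : UT F n} (h : ∀ p q, ent p q x = ent p q y) : x = y :=
  Subtype.ext (Matrix.ext h)

theorem ent_mul (p q : Fin n) (x y : UT F n) :
    ent p q (x * y) = ∑ r, ent p r x * ent r q y := rfl

theorem ent_one (p q : Fin n) : ent p q (1 : UT F n) = if p = q then 1 else 0 := rfl

/-- The matrix unit `E_{pq}` if `p ≤ q`, and zero otherwise. -/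
def unit (F : Type*) [Field F] {n : ℕ} (p q : Fin n) : UT F n :=
  if h : p ≤ q then ⟨Matrix.single p q 1, fun i j hij => by
    rw [Matrix.single_apply_of_ne]
    rintro ⟨rfl, rfl⟩
    exact absurd h (not_le.2 hij)⟩ else 0

theorem ent_unit {p q : Fin n} (h : p ≤ q) (i j : Fin n) :
    ent i j (unit F p q) = if p = i ∧ q = j then 1 else 0 := by
  rw [unit, dif_pos h]
  rfl

theorem unit_mul_unit {p q i j : Fin n} (h : p ≤ q) (h' : i ≤ j) :
    unit F p q * unit F i j = if q = i then unit F p j else 0 := by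
  refine ext_ent fun a b => ?_
  rw [ent_mul]
  simp only [ent_unit h, ent_unit h']
  split_ifs with hq
  · subst hq
    rw [ent_unit (h.trans h'), Finset.sum_eq_single q]
    · by_cases h1 : p = a <;> by_cases h2 : j = b <;> simp [h1, h2]
    · intro r _ hr
      simp [Ne.symm hr]
    · simp
  · refine Finset.sum_eq_zero fun r _ => ?_
    by_cases h1 : q = r
    · subst h1
      simp [Ne.symm hq]
    · simp [h1]

theorem eq_sum_unit (x : UT F n) : x = ∑ p, ∑ q, ent p q x • unit F p q := by
  refine ext_ent fun i j => ?_
  simp only [map_sum, map_smul, smul_eq_mul]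
  rw [Finset.sum_eq_single i, Finset.sum_eq_single j]
  · rcases le_or_gt i j with h | h
    · simp [ent_unit h]
    · simp [ent_of_lt h]
  · intro q _ hq
    rcases le_or_gt i q with h | h
    · simp [ent_unit h, hq]
    · simp [ent_of_lt h]
  · simp
  · intro p _ hp
    refine Finset.sum_eq_zero fun q _ => ?_
    rcases le_or_gt p q with h | h
    · simp [ent_unit h, hp]
    · simp [ent_of_lt h]
  · simp

theorem ent_diag_mul (v : Fin n) (x y : UT F n) :
    ent v v (x * y) = ent v v x * ent v v y := by
  rw [ent_mul, Finset.sum_eq_single v]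
  · intro r _ hr
    rcases lt_or_gt_of_ne hr with h | h
    · rw [ent_of_lt h, zero_mul]
    · rw [ent_of_lt h, mul_zero]
  · simp

/-- The diagonal entry `x ↦ x v v` as an algebra homomorphism. -/
def diagHom (F : Type*) [Field F] {n : ℕ} (v : Fin n) : UT F n →ₐ[F] F :=
  AlgHom.ofLinearMap (ent v v) (by rw [ent_one, if_pos rfl]) (ent_diag_mul v)

theorem diagHom_apply (v : Fin n) (x : UT F n) : diagHom F v x = ent v v x := rfl

theorem ent_superdiag_mul {N : ℕ} (e : Fin N) (x y : UT F (N + 1)) :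
    ent e.castSucc e.succ (x * y) = ent e.castSucc e.castSucc x * ent e.castSucc e.succ y +
      ent e.castSucc e.succ x * ent e.succ e.succ y := by
  rw [ent_mul, ← Finset.sum_subset (Finset.subset_univ {e.castSucc, e.succ}),
    Finset.sum_pair e.castSucc_lt_succ.ne]
  intro r _ hr
  simp only [Finset.mem_insert, Finset.mem_singleton, not_or] at hr
  rcases lt_or_gt_of_ne hr.1 with h | h
  · rw [ent_of_lt h, zero_mul]
  · have h' : e.succ < r := by
      refine lt_of_le_of_ne ?_ (Ne.symm hr.2)
      rw [Fin.lt_def] at h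
      rw [Fin.le_def]
      simpa using h
    rw [ent_of_lt h', mul_zero]

/-- Every homomorphism `UT_n → F` is a diagonal entry. -/
theorem exists_eq_diagHom (χ : UT F n →ₐ[F] F) : ∃ v, χ = diagHom F v := by
  have hlt : ∀ p q : Fin n, p < q → χ (unit F p q) = 0 := fun p q h => by
    have := congrArg χ (unit_mul_unit (F := F) h.le h.le)
    rw [if_neg h.ne', map_mul, map_zero] at this
    exact mul_self_eq_zero.1 this
  have hsum : ∀ x, χ x = ∑ p, ent p p x * χ (unit F p p) := fun x => by
    conv_lhs => rw [eq_sum_unit x]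
    simp only [map_sum, map_smul, smul_eq_mul]
    refine Finset.sum_congr rfl fun p _ => Finset.sum_eq_single p (fun q _ hq => ?_) (by simp)
    rcases lt_or_gt_of_ne hq with h | h
    · rw [ent_of_lt h, zero_mul]
    · rw [hlt p q h, mul_zero]
  obtain ⟨v, hv⟩ : ∃ v, χ (unit F v v) ≠ 0 := by
    by_contra! h
    have := hsum 1
    simp [h] at this
  have hv1 : χ (unit F v v) = 1 := by
    have := congrArg χ (unit_mul_unit (F := F) (le_refl v) (le_refl v))
    rw [if_pos rfl, map_mul] at this
    exact mul_left_cancel₀ hv (this.trans (mul_one _).symm)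
  refine ⟨v, AlgHom.ext fun x => ?_⟩
  rw [hsum, diagHom_apply, Finset.sum_eq_single v, hv1, mul_one]
  · intro p _ hp
    have := congrArg χ (unit_mul_unit (F := F) (le_refl p) (le_refl v))
    rw [if_neg hp, map_mul, map_zero, hv1, mul_one] at this
    rw [this, mul_zero]
  · simp

end UT

namespace AlgInvolution

variable {F A : Type*} [Field F] [Ring A] [Algebra F A] (σ : AlgInvolution F A)

theorem apply_mul (a b : A) :
    σ.toLinearMap (a * b) = σ.toLinearMap b * σ.toLinearMap a := σ.map_mul' a b

theorem apply_apply (a : A) : σ.toLinearMap (σ.toLinearMap a) = a := σ.involutive' a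

theorem apply_one : σ.toLinearMap 1 = 1 := by
  have h := σ.apply_mul (σ.toLinearMap 1) 1
  rw [mul_one, σ.apply_apply, mul_one] at h
  exact h.symm

/-- The composition of an involution with a homomorphism to a commutative algebra. -/
def compHom {B : Type*} [CommRing B] [Algebra F B] (χ : A →ₐ[F] B) : A →ₐ[F] B :=
  AlgHom.ofLinearMap (χ.toLinearMap ∘ₗ σ.toLinearMap) (by simp [σ.apply_one])
    (fun x y => by simp [σ.apply_mul, mul_comm])

end AlgInvolution

/-! ### The shape of an involution on the diagonal and the superdiagonal. -/

namespace UT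

variable {F : Type*} [Field F] {N : ℕ} (σ : AlgInvolution F (UT F (N + 1)))

/-- Composed with a map to a commutative ring, an anti-homomorphism is a homomorphism, so the
classification of characters applies. -/
theorem exists_perm_diag : ∃ π : Fin (N + 1) → Fin (N + 1), ∀ v x,
    ent v v (σ.toLinearMap x) = ent (π v) (π v) x := by
  choose π hπ using fun v => exists_eq_diagHom (σ.compHom (diagHom F v))
  exact ⟨π, fun v x => DFunLike.congr_fun (hπ v) x⟩

/-- Apply `∗` to `E_pq = E_pq E_qq` and `E_pq = E_pp E_pq`. Since `E_pq∗` has zero diagonal, its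
superdiagonal entry gets multiplied by a diagonal entry of `E_qq∗`, respectively `E_pp∗`, which
therefore cannot vanish. -/
theorem involution_unit_superdiag {π : Fin (N + 1) → Fin (N + 1)}
    (hπ : ∀ v x, ent v v (σ.toLinearMap x) = ent (π v) (π v) x) {p q : Fin (N + 1)} (h : p < q)
    {e : Fin N} (he : ent e.castSucc e.succ (σ.toLinearMap (unit F p q)) ≠ 0) :
    π e.castSucc = q ∧ π e.succ = p := by
  have h0 : ∀ v, ent v v (σ.toLinearMap (unit F p q)) = 0 := fun v => by
    rw [hπ, ent_unit h.le, if_neg]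
    rintro ⟨h1, h2⟩
    exact h.ne (h1.trans h2.symm)
  constructor
  · by_contra hne
    have h1 : σ.toLinearMap (unit F p q)
        = σ.toLinearMap (unit F q q) * σ.toLinearMap (unit F p q) := by
      rw [← σ.apply_mul, unit_mul_unit h.le le_rfl, if_pos rfl]
    refine he ?_
    rw [h1, ent_superdiag_mul, h0, hπ, ent_unit le_rfl, if_neg]
    · simp
    · exact fun h2 => hne h2.1.symm
  · by_contra hne
    have h1 : σ.toLinearMap (unit F p q)
        = σ.toLinearMap (unit F p q) * σ.toLinearMap (unit F p p) := by
      rw [← σ.apply_mul, unit_mul_unit le_rfl h.le, if_pos rfl]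
    refine he ?_
    rw [h1, ent_superdiag_mul, h0, hπ, ent_unit le_rfl, if_neg]
    · simp
    · exact fun h2 => hne h2.1.symm

/-- An involution reverses the diagonal. -/
theorem involution_diag (v : Fin (N + 1)) (x : UT F (N + 1)) :
    ent v v (σ.toLinearMap x) = ent v.rev v.rev x := by
  obtain ⟨π, hπ⟩ := exists_perm_diag σ
  -- Expand `E_{e,e+1}∗` in matrix units and apply `∗` again: some `E_pq∗` with `p < q` has a
  -- nonzero entry at `e`. So `π` is strictly decreasing.
  have hlt : ∀ e : Fin N, π e.succ < π e.castSucc := fun e => by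
    have h1 : ent e.castSucc e.succ
        (σ.toLinearMap (σ.toLinearMap (unit F e.castSucc e.succ))) ≠ 0 := by
      rw [σ.apply_apply, ent_unit e.castSucc_lt_succ.le]
      simp
    rw [eq_sum_unit (σ.toLinearMap (unit F e.castSucc e.succ))] at h1
    simp only [map_sum, map_smul, smul_eq_mul] at h1
    obtain ⟨p, -, hp⟩ := Finset.exists_ne_zero_of_sum_ne_zero h1
    obtain ⟨q, -, hq⟩ := Finset.exists_ne_zero_of_sum_ne_zero hp
    have hpq : p < q := by
      rcases lt_trichotomy p q with h | h | h
      · exact h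
      · subst h
        refine absurd ?_ hq
        rw [hπ, ent_unit e.castSucc_lt_succ.le, if_neg, zero_mul]
        rintro ⟨h2, h3⟩
        exact e.castSucc_lt_succ.ne (h2.trans h3.symm)
      · exact absurd (by rw [ent_of_lt h, zero_mul]) hq
    obtain ⟨h2, h3⟩ := involution_unit_superdiag σ hπ hpq (right_ne_zero_of_mul hq)
    rw [h2, h3]
    exact hpq
  have hmono : StrictMono (Fin.rev ∘ π) := by
    rw [Fin.strictMono_iff_lt_succ]
    intro e
    exact Fin.rev_lt_rev.2 (hlt e)
  have hid : Fin.rev ∘ π = id := by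
    have h1 := hmono.range_inj (g := id) strictMono_id
    rw [← h1, Set.range_id]
    exact (Finite.injective_iff_surjective.1 hmono.injective).range_eq
  have h2 : (π v).rev = v := congrFun hid v
  rw [hπ, show π v = v.rev by rw [← Fin.rev_rev (π v), h2]]

/-- An involution reverses the superdiagonal, up to scalars and modulo the diagonal. -/
theorem exists_involution_superdiag (e : Fin N) : ∃ c : F, c ≠ 0 ∧ ∃ l : Fin (N + 1) → F, ∀ x,
    ent e.castSucc e.succ (σ.toLinearMap x) =
      c * ent e.rev.castSucc e.rev.succ x + ∑ v, l v * ent v v x := by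
  have hx : ∀ x, ent e.castSucc e.succ (σ.toLinearMap x) =
      ent e.castSucc e.succ (σ.toLinearMap (unit F e.rev.castSucc e.rev.succ)) *
        ent e.rev.castSucc e.rev.succ x +
      ∑ v, ent e.castSucc e.succ (σ.toLinearMap (unit F v v)) * ent v v x := fun x => by
    have h1 : ∀ p q : Fin (N + 1), ent p q x *
        ent e.castSucc e.succ (σ.toLinearMap (unit F p q)) =
        (if p = e.rev.castSucc then if q = e.rev.succ then
          ent e.castSucc e.succ (σ.toLinearMap (unit F e.rev.castSucc e.rev.succ)) *
          ent e.rev.castSucc e.rev.succ x else 0 else 0) +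
        if q = p then ent e.castSucc e.succ (σ.toLinearMap (unit F p p)) * ent p p x
          else 0 := fun p q => by
      rcases lt_trichotomy p q with h | h | h
      · rw [if_neg h.ne', add_zero]
        by_cases h0 : ent e.castSucc e.succ (σ.toLinearMap (unit F p q)) = 0
        · rw [h0, mul_zero]
          split_ifs with h2 h3
          · subst h2 h3
            rw [h0, zero_mul]
          · rfl
          · rfl
        · obtain ⟨h2, h3⟩ := involution_unit_superdiag σ (involution_diag σ) h h0
          rw [Fin.rev_castSucc] at h2
          rw [Fin.rev_succ] at h3
          subst h2 h3
          simp [mul_comm]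
      · subst h
        rw [if_pos rfl, mul_comm]
        by_cases h2 : p = e.rev.castSucc
        · subst h2
          rw [if_pos rfl, if_neg e.rev.castSucc_lt_succ.ne, zero_add]
        · rw [if_neg h2, zero_add]
      · rw [ent_of_lt h, zero_mul, if_neg h.ne, add_zero]
        split_ifs with h2 h3
        · subst h2 h3
          exact absurd h e.rev.castSucc_lt_succ.not_gt
        · rfl
        · rfl
    conv_lhs => rw [eq_sum_unit x]
    simp only [map_sum, map_smul, smul_eq_mul, h1, Finset.sum_add_distrib]
    simp
  refine ⟨_, fun h0 => ?_, _, hx⟩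
  -- If the scalar were zero, then at `E_{e,e+1}∗`, whose diagonal vanishes, the formula would read
  -- `1 = 0`.
  have h2 := hx (σ.toLinearMap (unit F e.castSucc e.succ))
  rw [h0, zero_mul, zero_add, σ.apply_apply, ent_unit e.castSucc_lt_succ.le,
    if_pos ⟨rfl, rfl⟩, Finset.sum_eq_zero] at h2
  · exact one_ne_zero h2
  · intro v _
    rw [involution_diag, ent_unit e.castSucc_lt_succ.le, if_neg, mul_zero]
    rintro ⟨h3, h4⟩
    exact e.castSucc_lt_succ.ne (h3.trans h4.symm)

end UT

/-! ### Codimensions as dimensions of spaces of functions. -/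

section Codim

variable {F A : Type*} [Field F] [Ring A] [Algebra F A] (σ : AlgInvolution F A)

/-- The map from `∗`-polynomials to the functions which they define. -/
def starFun : FreeStarAlg F →ₗ[F] ((ℕ → A) → A) :=
  LinearMap.pi fun a => (starEval σ a).toLinearMap

theorem starEval_starVar (a : ℕ → A) (i : ℕ) (d : Bool) :
    starEval σ a (starVar F i d) = bif d then σ.toLinearMap (a i) else a i := by
  cases d <;> simp [starVar, freeInvolution, freeStarHom, starEval]

theorem starCodim_eq_finrank_map (m : ℕ) :
    starCodim σ m = Module.finrank F ((multilinearStar F m).map (starFun σ)) := by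
  have h : (starIdentities σ).submoduleOf (multilinearStar F m)
      = LinearMap.ker ((starFun σ).domRestrict (multilinearStar F m)) := by
    ext f
    simp only [Submodule.submoduleOf, Submodule.mem_comap, LinearMap.mem_ker]
    exact ⟨fun hf => funext hf, fun hf a => congrFun hf a⟩
  rw [starCodim, h, LinearEquiv.finrank_eq (LinearMap.quotKerEquivRange _),
    LinearMap.range_domRestrict]

end Codim


/-! ### Encoding the dominant labellings. -/

/-- The index set for the dominant monomials: an injective choice `k` of a letter for every
superdiagonal position, one bit for every pair of opposite superdiagonal positions, and a diagonal
position for each of the remaining letters. -/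
abbrev MainIndex (N m : ℕ) : Type :=
  Σ k : Fin N ↪ Fin m, (Fin (N / 2) → Bool) × ({i // i ∉ Set.range k} → Fin (N + 1))

open Classical in
theorem card_mainIndex (N m : ℕ) :
    Fintype.card (MainIndex N m) = m.descFactorial N * (2 ^ (N / 2) * (N + 1) ^ (m - N)) := by
  rw [Fintype.card_sigma, Finset.sum_congr rfl (g := fun _ => 2 ^ (N / 2) * (N + 1) ^ (m - N))]
  · rw [Finset.sum_const, Finset.card_univ, Fintype.card_embedding_eq, Fintype.card_fin,
      Fintype.card_fin, smul_eq_mul]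
  · intro k _
    have h : Fintype.card {i // i ∉ Set.range k} = m - N := by
      rw [Fintype.card_subtype_compl, Fintype.card_fin]
      congr 1
      exact (Fintype.card_congr (Equiv.ofInjective k k.injective).symm).trans (Fintype.card_fin N)
    rw [Fintype.card_prod, Fintype.card_fun, Fintype.card_fun, h]
    simp

namespace MainIndex

variable {N m : ℕ}

/-- The bit which belongs to the pair `{e, e.rev}`. -/
def bit (ε : Fin (N / 2) → Bool) (e : Fin N) : Bool :=
  if h : (min e e.rev : Fin N).val < N / 2 then ε ⟨_, h⟩ else true

theorem bit_rev (ε : Fin (N / 2) → Bool) (e : Fin N) : bit ε e.rev = bit ε e := by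
  simp only [bit, Fin.rev_rev, min_comm]

/-- The superdiagonal position at which the letter `k e` is read. -/
def target (t : MainIndex N m) (e : Fin N) : Fin N :=
  if bit t.2.1 e then e
  else if t.1 (min e e.rev) < t.1 (max e e.rev) then min e e.rev else max e e.rev

theorem target_eq_or (t : MainIndex N m) (e : Fin N) : t.target e = e ∨ t.target e = e.rev := by
  rw [target]
  split_ifs
  · exact Or.inl rfl
  · exact min_choice _ _
  · exact max_choice _ _

open Classical in
/-- The labels of the letters: a diagonal position or a superdiagonal position. -/
def label (t : MainIndex N m) (i : Fin m) : Fin (N + 1) ⊕ Fin N :=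
  if h : i ∈ Set.range t.1 then Sum.inr (t.target h.choose) else Sum.inl (t.2.2 ⟨i, h⟩)

theorem label_special (t : MainIndex N m) (e : Fin N) :
    t.label (t.1 e) = Sum.inr (t.target e) := by
  have h : t.1 e ∈ Set.range t.1 := ⟨e, rfl⟩
  rw [label, dif_pos h, t.1.injective h.choose_spec]

theorem label_rest (t : MainIndex N m) (i : {i // i ∉ Set.range t.1}) :
    t.label i = Sum.inl (t.2.2 i) := by
  rw [label, dif_neg i.2]

theorem lt_half_iff (e : Fin N) : e.val < N / 2 ↔ e < e.rev := by
  rw [Fin.lt_def, Fin.val_rev]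
  omega

/-- The letters with superdiagonal labels form the range of the embedding, and labels assign them to
mirror pairs. Distinct labels within a pair mean bit `true` and tell the two letters apart. Equal
labels mean bit `false`, and the common label records which of the two letters comes first. -/
theorem label_injective : Function.Injective (label : MainIndex N m → _) := by
  intro t t' h
  have hrange : ∀ i, i ∈ Set.range t.1 ↔ ∃ e, t.label i = Sum.inr e := fun i => by
    constructor
    · rintro ⟨e, rfl⟩
      exact ⟨_, t.label_special e⟩
    · rintro ⟨e, he⟩
      by_contra hi
      rw [t.label_rest ⟨i, hi⟩] at he
      exact Sum.inl_ne_inr he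
  have hrange' : ∀ i, i ∈ Set.range t'.1 ↔ ∃ e, t'.label i = Sum.inr e := fun i => by
    constructor
    · rintro ⟨e, rfl⟩
      exact ⟨_, t'.label_special e⟩
    · rintro ⟨e, he⟩
      by_contra hi
      rw [t'.label_rest ⟨i, hi⟩] at he
      exact Sum.inl_ne_inr he
  have hr : Set.range t.1 = Set.range t'.1 := by
    ext i
    rw [hrange, hrange', h]
  -- the letter at `e` is determined by the labels of the pair `{e, e.rev}`
  have hpair : ∀ e, t.1 e = t'.1 e ∨ t.1 e = t'.1 e.rev := fun e => by
    obtain ⟨e', he'⟩ : t.1 e ∈ Set.range t'.1 := hr ▸ ⟨e, rfl⟩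
    have h1 := congrFun h (t.1 e)
    rw [t.label_special, ← he', t'.label_special, Sum.inr.injEq] at h1
    rw [← he', t'.1.injective.eq_iff, t'.1.injective.eq_iff]
    rcases t.target_eq_or e with h2 | h2 <;> rcases t'.target_eq_or e' with h3 | h3 <;>
      rw [h2, h3] at h1
    · exact Or.inl h1.symm
    · exact Or.inr (by rw [h1, Fin.rev_rev])
    · exact Or.inr h1.symm
    · exact Or.inl (Fin.rev_injective h1).symm
  have htgt : ∀ e e', t.1 e = t'.1 e' → t.target e = t'.target e' := fun e e' he => by
    have h1 := congrFun h (t.1 e)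
    rwa [t.label_special, he, t'.label_special, Sum.inr.injEq] at h1
  have hmain : ∀ e : Fin N, e < e.rev → t.1 e = t'.1 e ∧ t.1 e.rev = t'.1 e.rev ∧
      bit t.2.1 e = bit t'.2.1 e := fun e he => by
    have hmin : min e e.rev = e := min_eq_left he.le
    have hmax : max e e.rev = e.rev := max_eq_right he.le
    have hmin' : min e.rev e = e := min_eq_right he.le
    have hmax' : max e.rev e = e.rev := max_eq_left he.le
    have hT : ∀ s : MainIndex N m, s.target e = if bit s.2.1 e then e else
        if s.1 e < s.1 e.rev then e else e.rev := fun s => by rw [target, hmin, hmax]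
    have hT' : ∀ s : MainIndex N m, s.target e.rev = if bit s.2.1 e then e.rev else
        if s.1 e < s.1 e.rev then e else e.rev := fun s => by
      rw [target, Fin.rev_rev, hmin', hmax', bit_rev]
    have hne : e ≠ e.rev := he.ne
    rcases hpair e with h1 | h1
    · have h2 : t.1 e.rev = t'.1 e.rev := by
        rcases hpair e.rev with h2 | h2
        · exact h2
        · rw [Fin.rev_rev, ← h1, t.1.injective.eq_iff] at h2
          exact absurd h2.symm hne
      refine ⟨h1, h2, ?_⟩
      have h3 := htgt _ _ h1
      have h4 := htgt _ _ h2
      rw [hT, hT, h1, h2] at h3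
      rw [hT', hT', h1, h2] at h4
      cases hb : bit t.2.1 e <;> cases hb' : bit t'.2.1 e <;> simp only [hb, hb'] at h3 h4 <;>
        first
        | rfl
        | (exfalso; split_ifs at h3 h4 <;> first
            | exact hne h3 | exact hne h3.symm | exact hne h4 | exact hne h4.symm | contradiction)
    · have h2 : t.1 e.rev = t'.1 e := by
        rcases hpair e.rev with h2 | h2
        · rw [← h1, t.1.injective.eq_iff] at h2
          exact absurd h2.symm hne
        · rwa [Fin.rev_rev] at h2
      exfalso
      have h3 := htgt _ _ h1
      have h4 := htgt _ _ h2
      rw [hT, hT', h1, h2] at h3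
      rw [hT', hT, h1, h2] at h4
      have h5 : t'.1 e ≠ t'.1 e.rev := fun h => hne (t'.1.injective h)
      cases hb : bit t.2.1 e <;> cases hb' : bit t'.2.1 e <;> simp only [hb, hb'] at h3 h4
      · rcases lt_or_gt_of_ne h5 with h6 | h6
        · simp [h6, h6.not_gt, hne.symm] at h3
        · simp [h6, h6.not_gt, hne] at h3
      · split_ifs at h3 h4 <;> first
          | exact hne h3 | exact hne h3.symm | exact hne h4 | exact hne h4.symm
      · split_ifs at h3 h4 <;> first
          | exact hne h3 | exact hne h3.symm | exact hne h4 | exact hne h4.symm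
      · exact hne (by simpa using h3)
  obtain ⟨k, ε, ρ⟩ := t
  obtain ⟨k', ε', ρ'⟩ := t'
  have hk : k = k' := by
    ext e : 1
    rcases lt_trichotomy e e.rev with he | he | he
    · exact (hmain e he).1
    · rcases hpair e with h1 | h1
      · exact h1
      · rw [← he] at h1
        exact h1
    · have := (hmain e.rev (by rwa [Fin.rev_rev])).2.1
      rwa [Fin.rev_rev] at this
  subst hk
  have hε : ε = ε' := by
    ext i : 1
    have hi : i.val < N := i.2.trans_le (Nat.div_le_self _ _)
    have he : (⟨i.val, hi⟩ : Fin N) < Fin.rev ⟨i.val, hi⟩ := (lt_half_iff _).1 i.2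
    have h1 := (hmain _ he).2.2
    have h2 : min (⟨i.val, hi⟩ : Fin N) (Fin.rev ⟨i.val, hi⟩) = ⟨i.val, hi⟩ := min_eq_left he.le
    simpa only [bit, h2, i.2, dif_pos] using h1
  subst hε
  have hρ : ρ = ρ' := by
    ext i : 1
    have h1 := congrFun h i.1
    rw [label_rest ⟨k, ε, ρ⟩ i, label_rest ⟨k, ε, ρ'⟩ i] at h1
    exact Sum.inl_injective h1
  rw [hρ]

/-- This makes the encoding exhaustive: the dominant monomials met in the expansion all come from
`MainIndex`. The bit of a pair says whether its labels differ; the embedding is `κ` after exchanging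
letters within pairs where necessary. -/
theorem exists_label_eq (φ : Fin m → Fin (N + 1) ⊕ Fin N) (κ : Fin N ↪ Fin m)
    (hκ : ∀ e, φ (κ e) = Sum.inr e ∨ φ (κ e) = Sum.inr e.rev)
    (hφ : ∀ i, i ∉ Set.range κ → ∃ v, φ i = Sum.inl v) : ∃ t : MainIndex N m, t.label = φ := by
  classical
  obtain ⟨L, hL⟩ : ∃ L : Fin N → Fin N, ∀ e, φ (κ e) = Sum.inr (L e) :=
    ⟨fun e => if φ (κ e) = Sum.inr e then e else e.rev, fun e => by
      dsimp only
      split_ifs with h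
      · exact h
      · exact (hκ e).resolve_left h⟩
  have hL' : ∀ e, L e = e ∨ L e = e.rev := fun e => by simpa [hL] using hκ e
  -- `sw e`: the letters of the pair `{e, e.rev}` have to be exchanged
  obtain ⟨sw, hsw⟩ : ∃ sw : Fin N → Prop, ∀ e, sw e ↔
      (L (min e e.rev) = max e e.rev ∧ L (max e e.rev) = min e e.rev) ∨
      (L (min e e.rev) = min e e.rev ∧ L (max e e.rev) = min e e.rev ∧
        κ (max e e.rev) < κ (min e e.rev)) ∨
      (L (min e e.rev) = max e e.rev ∧ L (max e e.rev) = max e e.rev ∧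
        κ (min e e.rev) < κ (max e e.rev)) := ⟨_, fun e => Iff.rfl⟩
  have hswrev : ∀ e, sw e.rev ↔ sw e := fun e => by
    rw [hsw, hsw, Fin.rev_rev, min_comm, max_comm]
  obtain ⟨p, hp⟩ : ∃ p : Fin N → Fin N, ∀ e, p e = if sw e then e.rev else e := ⟨_, fun _ => rfl⟩
  have hpp : ∀ e, p (p e) = e := fun e => by
    by_cases h : sw e <;> simp [hp, h, hswrev]
  have hpinj : Function.Injective p := Function.LeftInverse.injective hpp
  let k : Fin N ↪ Fin m := ⟨κ ∘ p, κ.injective.comp hpinj⟩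
  have hk : ∀ e, k e = κ (p e) := fun _ => rfl
  have hkr : Set.range k = Set.range κ := by
    have : Function.Surjective p := fun e => ⟨p e, hpp e⟩
    exact this.range_comp κ
  choose ρ hρ using fun i : {i // i ∉ Set.range k} => hφ i.1 (hkr ▸ i.2)
  let ε : Fin (N / 2) → Bool := fun i =>
    decide (L ⟨i.val, i.2.trans_le (Nat.div_le_self _ _)⟩
      ≠ L (Fin.rev ⟨i.val, i.2.trans_le (Nat.div_le_self _ _)⟩))
  refine ⟨⟨k, ε, ρ⟩, funext fun i => ?_⟩
  by_cases hi : i ∈ Set.range k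
  · obtain ⟨e, rfl⟩ := hi
    rw [label_special ⟨k, ε, ρ⟩, hk, hL, Sum.inr.injEq]
    have hmain : ∀ e : Fin N, e < e.rev → target ⟨k, ε, ρ⟩ e = L (p e) ∧
        target ⟨k, ε, ρ⟩ e.rev = L (p e.rev) := fun e he => by
      have hmin : min e e.rev = e := min_eq_left he.le
      have hmax : max e e.rev = e.rev := max_eq_right he.le
      have hmin' : min e.rev e = e := min_eq_right he.le
      have hmax' : max e.rev e = e.rev := max_eq_left he.le
      have hb : bit ε e = decide (L e ≠ L e.rev) := by
        have : e.val < N / 2 := (lt_half_iff e).2 he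
        simp only [bit, this, dif_pos, ε, hmin, Fin.eta]
      have hne : e ≠ e.rev := he.ne
      have hS := hsw e
      rw [hmin, hmax] at hS
      have hS' := hswrev e
      have h5 : κ e ≠ κ e.rev := fun h => hne (κ.injective h)
      simp only [target, Fin.rev_rev, hmin, hmax, hmin', hmax', bit_rev, hb, hk, hp, hS', hS]
      have h1 := hL' e
      have h2 := hL' e.rev
      rw [Fin.rev_rev] at h2
      rcases h1 with h1 | h1 <;> rcases h2 with h2 | h2 <;> rcases lt_or_gt_of_ne h5 with h6 | h6 <;>
        simp [h1, h2, h6, h6.not_gt, hne, hne.symm]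
    rcases lt_trichotomy e e.rev with he | he | he
    · exact (hmain e he).1
    · have h1 : target ⟨k, ε, ρ⟩ e = e := by
        rcases target_eq_or ⟨k, ε, ρ⟩ e with h | h
        · exact h
        · rw [h, ← he]
      have h2 : p e = e := by
        rw [hp]
        split_ifs
        · exact he.symm
        · rfl
      rw [h1, h2]
      rcases hL' e with h | h
      · exact h.symm
      · rw [h, ← he]
    · have := (hmain e.rev (by rwa [Fin.rev_rev])).2
      rwa [Fin.rev_rev] at this
  · rw [label_rest ⟨k, ε, ρ⟩ ⟨i, hi⟩]
    exact (hρ ⟨i, hi⟩).symm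

end MainIndex


/-! ### The upper bound: expansion along paths. -/

namespace UT

variable {F : Type*} [Field F] {N m : ℕ}

/-- The multilinear function `a ↦ ∏ i, (a i)_{φ i}`. -/
def mon (F : Type*) [Field F] {n m : ℕ} (φ : Fin m → Fin n × Fin n) : (ℕ → UT F n) → F :=
  fun a => ∏ i, ent (φ i).1 (φ i).2 (a i)

/-- Multiplying out a product of functionals, while remembering for every letter which entries may
occur. -/
theorem prod_mem_span_mon {n : ℕ} (B : Fin m → Set (Fin n × Fin n)) (h : Fin m → UT F n →ₗ[F] F)
    (hB : ∀ i, h i ∈ Submodule.span F ((fun b => ent b.1 b.2) '' B i)) :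
    (fun a : ℕ → UT F n => ∏ i, h i (a i)) ∈
      Submodule.span F (mon F '' {φ | ∀ i, φ i ∈ B i}) := by
  let S : Fin m → Set ((ℕ → UT F n) → F) := fun i => (fun b a => ent b.1 b.2 (a i)) '' B i
  have h1 : ∀ i, (fun a : ℕ → UT F n => h i (a i)) ∈ Submodule.span F (S i) := fun i => by
    let c : (UT F n →ₗ[F] F) →ₗ[F] ((ℕ → UT F n) → F) :=
      { toFun := fun l a => l (a i)
        map_add' := fun _ _ => rfl
        map_smul' := fun _ _ => rfl }
    have h2 := Submodule.mem_map_of_mem (f := c) (hB i)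
    rw [Submodule.map_span, Set.image_image] at h2
    exact h2
  have h3 : ∀ s : Finset (Fin m), ∏ i ∈ s, (fun a : ℕ → UT F n => h i (a i)) ∈
      ∏ i ∈ s, Submodule.span F (S i) := fun s => by
    classical
    induction s using Finset.induction_on with
    | empty => simp only [Finset.prod_empty]; exact Submodule.one_le.1 le_rfl
    | insert i s hi ih =>
      rw [Finset.prod_insert hi, Finset.prod_insert hi]
      exact Submodule.mul_mem_mul (h1 i) ih
  have h4 := h3 Finset.univ
  rw [Submodule.prod_span] at h4
  have h5 : (∏ i, fun a : ℕ → UT F n => h i (a i)) = fun a => ∏ i, h i (a i) := by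
    ext a
    simp
  rw [h5] at h4
  refine Submodule.span_mono ?_ h4
  intro g hg
  rw [Set.mem_fintype_prod] at hg
  obtain ⟨f, hf, rfl⟩ := hg
  choose φ hφ hφ' using hf
  refine ⟨φ, hφ, ?_⟩
  ext a
  rw [Finset.prod_apply]
  exact Finset.prod_congr rfl fun i _ => congrFun (hφ' i) a

theorem ent_prod_ofFn {n : ℕ} (Y : Fin m → UT F n) (p q : Fin n) :
    ent p q (List.ofFn Y).prod = ∑ v : Fin (m + 1) → Fin n,
      if v 0 = p ∧ v (Fin.last m) = q then
        ∏ k : Fin m, ent (v k.castSucc) (v k.succ) (Y k) else 0 := by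
  induction m generalizing p with
  | zero =>
    rw [List.ofFn_zero, List.prod_nil, ent_one, ← (Equiv.funUnique (Fin 1) (Fin n)).symm.sum_comp]
    by_cases h : p = q
    · subst h
      simp
    · rw [if_neg h, Finset.sum_eq_zero]
      intro x _
      rw [if_neg]
      rintro ⟨h1, h2⟩
      exact h (h1.symm.trans h2)
  | succ m ih =>
    rw [List.ofFn_succ, List.prod_cons, ent_mul,
      ← (Fin.consEquiv (fun _ : Fin (m + 2) => Fin n)).sum_comp, Fintype.sum_prod_type]
    refine Eq.trans ?_ (Finset.sum_eq_single p ?_ ?_).symm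
    · have h1 : ∀ v : Fin (m + 1) → Fin n, (if (Fin.cons p v : Fin (m + 2) → Fin n) 0 = p ∧
          (Fin.cons p v : Fin (m + 2) → Fin n) (Fin.last (m + 1)) = q then
          ∏ k : Fin (m + 1), ent ((Fin.cons p v : Fin (m + 2) → Fin n) k.castSucc)
            ((Fin.cons p v : Fin (m + 2) → Fin n) k.succ) (Y k) else 0) =
          ∑ r, ent p r (Y 0) * if v 0 = r ∧ v (Fin.last m) = q then
            ∏ k : Fin m, ent (v k.castSucc) (v k.succ) (Y k.succ) else 0 := fun v => by
        rw [Finset.sum_eq_single (v 0)]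
        · rw [Fin.prod_univ_succ, ← Fin.succ_last]
          simp only [Fin.cons_zero, Fin.cons_succ, Fin.castSucc_zero, ← Fin.succ_castSucc,
            true_and, mul_ite, mul_zero]
        · intro r _ hr
          rw [if_neg fun h => hr h.1.symm, mul_zero]
        · simp
      simp only [Fin.consEquiv_apply]
      rw [Finset.sum_congr rfl fun v _ => h1 v, Finset.sum_comm]
      refine Finset.sum_congr rfl fun r _ => ?_
      rw [ih, Finset.mul_sum]
    · intro r _ hr
      refine Finset.sum_eq_zero fun v _ => if_neg ?_
      rintro ⟨h, -⟩
      exact hr h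
    · simp

theorem sum_succ_sub_castSucc (f : Fin (m + 1) → ℤ) :
    ∑ k : Fin m, (f k.succ - f k.castSucc) = f (Fin.last m) - f 0 := by
  induction m with
  | zero => simp
  | succ m ih =>
    rw [Fin.sum_univ_castSucc]
    have := ih fun k => f k.castSucc
    simp only [Fin.succ_castSucc] at this ⊢
    rw [this]
    simp

/-- The entry which belongs to a label. -/
def coord : Fin (N + 1) ⊕ Fin N → Fin (N + 1) × Fin (N + 1) :=
  Sum.elim (fun v => (v, v)) fun e => (e.castSucc, e.succ)

/-- The labellings with fewer than `N` off-diagonal entries. -/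
abbrev LowIndex (N m : ℕ) : Type :=
  {φ : Fin m → Fin (N + 1) × Fin (N + 1) //
    (Finset.univ.filter fun i => (φ i).1 ≠ (φ i).2).card < N}

/-- Such a labelling is encoded by `N - 1` positions, the entries there, and diagonal labels
elsewhere. This has one power of `m` fewer than the main term, whence the factor `m` on the left. -/
theorem card_lowIndex_mul_le (N m : ℕ) :
    Fintype.card (LowIndex N m) * m ≤ ((N + 1) * (N + 1)) ^ N * (m ^ N * (N + 1) ^ m) := by
  classical
  rcases N with - | k
  · have : IsEmpty (LowIndex 0 m) := ⟨fun φ => Nat.not_lt_zero _ φ.2⟩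
    simp
  rcases Nat.eq_zero_or_pos m with rfl | hm
  · simp
  let o : (Fin k → Fin m) × (Fin k → Fin (k + 2) × Fin (k + 2)) × (Fin m → Fin (k + 2)) →
      Fin m → Fin (k + 2) × Fin (k + 2) := fun x i =>
    if h : ∃ j, x.1 j = i then x.2.1 h.choose else (x.2.2 i, x.2.2 i)
  have ho : ∀ φ : LowIndex (k + 1) m, ∃ x, o x = φ.1 := by
    rintro ⟨φ, hφ⟩
    obtain ⟨f⟩ := Function.Embedding.nonempty_of_card_le
      (α := (Finset.univ.filter fun i => (φ i).1 ≠ (φ i).2)) (β := Fin k)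
      (by rw [Fintype.card_coe, Fintype.card_fin]; omega)
    -- The padding value is harmless, because the code stores the true label at every listed
    -- position.
    let pos : Fin k → Fin m := Function.extend f Subtype.val fun _ => ⟨0, hm⟩
    refine ⟨(pos, φ ∘ pos, fun i => (φ i).1), funext fun i => ?_⟩
    by_cases h : ∃ j, pos j = i
    · simp only [o, h, dif_pos, Function.comp_apply, h.choose_spec]
    · simp only [o, h, dif_neg, not_false_iff]
      by_contra hne
      have hi : (φ i).1 ≠ (φ i).2 := fun h' => hne (Prod.ext rfl h')
      exact h ⟨f ⟨i, by simpa using hi⟩, f.injective.extend_apply _ _ _⟩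
  choose g hg using ho
  have hginj : Function.Injective g := fun φ ψ h => Subtype.ext (by rw [← hg, h, hg])
  have h1 := Fintype.card_le_of_injective g hginj
  simp only [Fintype.card_prod, Fintype.card_fun, Fintype.card_fin] at h1
  calc Fintype.card (LowIndex (k + 1) m) * m
      ≤ m ^ k * (((k + 2) * (k + 2)) ^ k * (k + 2) ^ m) * m := Nat.mul_le_mul_right _ h1
    _ = ((k + 2) * (k + 2)) ^ k * (m ^ (k + 1) * (k + 2) ^ m) := by ring
    _ ≤ ((k + 2) * (k + 2)) ^ (k + 1) * (m ^ (k + 1) * (k + 2) ^ m) :=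
        Nat.mul_le_mul_right _ (Nat.pow_le_pow_right (by positivity) (Nat.le_succ k))

theorem functional_mem_span_ent {n : ℕ} (l : UT F n →ₗ[F] F) :
    l ∈ Submodule.span F ((fun b : Fin n × Fin n => ent b.1 b.2) '' Set.univ) := by
  have h : l = ∑ p, ∑ q, l (unit F p q) • ent p q := by
    ext x
    conv_lhs => rw [eq_sum_unit x]
    simp [mul_comm]
  rw [h]
  exact Submodule.sum_mem _ fun p _ => Submodule.sum_mem _ fun q _ =>
    Submodule.smul_mem _ _ (Submodule.subset_span ⟨(p, q), trivial, rfl⟩)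

variable (σ : AlgInvolution F (UT F (N + 1)))

/-- The labels which occur in the entry `(p, q)` of a letter `x` or `x∗`. -/
def allowed (p q : Fin (N + 1)) : Set (Fin (N + 1) × Fin (N + 1)) :=
  {b | (p = q → b.1 = b.2) ∧ ∀ e : Fin N, p = e.castSucc → q = e.succ →
    b.1 = b.2 ∨ b = coord (Sum.inr e) ∨ b = coord (Sum.inr e.rev)}

/-- The only place where the shape of the involution enters the upper bound. -/
theorem ent_star_mem_span (p q : Fin (N + 1)) (d : Bool) :
    (ent p q ∘ₗ (bif d then σ.toLinearMap else LinearMap.id) : UT F (N + 1) →ₗ[F] F) ∈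
      Submodule.span F ((fun b => ent b.1 b.2) '' allowed p q) := by
  have key : ∀ b ∈ allowed p q, (ent b.1 b.2 : UT F (N + 1) →ₗ[F] F) ∈
      Submodule.span F ((fun b => ent b.1 b.2) '' allowed p q) := fun b hb =>
    Submodule.subset_span ⟨b, hb, rfl⟩
  by_cases hpq : p = q
  · subst hpq
    have hall : ∀ w, (w, w) ∈ allowed p p := fun w => ⟨fun _ => rfl, fun e _ _ => Or.inl rfl⟩
    cases d
    · exact key _ (hall p)
    · have h1 : (ent p p ∘ₗ σ.toLinearMap : UT F (N + 1) →ₗ[F] F) = ent p.rev p.rev := by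
        ext x
        exact involution_diag σ p x
      simp only [cond_true, h1]
      exact key _ (hall p.rev)
  by_cases he : ∃ e : Fin N, p = e.castSucc ∧ q = e.succ
  · obtain ⟨e, rfl, rfl⟩ := he
    have hall : ∀ b : Fin (N + 1) × Fin (N + 1),
        b.1 = b.2 ∨ b = coord (Sum.inr e) ∨ b = coord (Sum.inr e.rev) →
        b ∈ allowed e.castSucc e.succ := fun b hb => by
      refine ⟨fun h => absurd h hpq, fun e' h _ => ?_⟩
      rw [Fin.castSucc_injective N h] at hb
      exact hb
    cases d
    · exact key _ (hall (coord (Sum.inr e)) (Or.inr (Or.inl rfl)))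
    · obtain ⟨c, -, l, hl⟩ := exists_involution_superdiag σ e
      have h1 : (ent e.castSucc e.succ ∘ₗ σ.toLinearMap : UT F (N + 1) →ₗ[F] F) =
          c • ent e.rev.castSucc e.rev.succ + ∑ v, l v • ent v v := by
        ext x
        simpa using hl x
      simp only [cond_true, h1]
      exact Submodule.add_mem _
        (Submodule.smul_mem _ _ (key _ (hall (coord (Sum.inr e.rev)) (Or.inr (Or.inr rfl)))))
        (Submodule.sum_mem _ fun v _ => Submodule.smul_mem _ _ (key _ (hall (v, v) (Or.inl rfl))))
  · refine Submodule.span_mono (Set.image_mono ?_) (functional_mem_span_ent _)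
    exact fun b _ => ⟨fun h => absurd h hpq, fun e h h' => absurd ⟨e, h, h'⟩ he⟩

/-- A monotone path with `N` proper steps runs through all the vertices. -/
theorem exists_steps (v : Fin (m + 1) → Fin (N + 1))
    (hv : ∀ k : Fin m, v k.castSucc ≤ v k.succ)
    (hN : N ≤ (Finset.univ.filter fun k : Fin m => v k.castSucc ≠ v k.succ).card) :
    v 0 = 0 ∧ v (Fin.last m) = Fin.last N ∧ ∃ κ : Fin N ↪ Fin m,
      (∀ e, v (κ e).castSucc = e.castSucc ∧ v (κ e).succ = e.succ) ∧
      ∀ k, v k.castSucc ≠ v k.succ → k ∈ Set.range κ := by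
  have hsum := sum_succ_sub_castSucc fun k => ((v k).val : ℤ)
  have hle : ∀ k ∈ (Finset.univ : Finset (Fin m)),
      (if v k.castSucc ≠ v k.succ then 1 else 0 : ℤ) ≤ (v k.succ).val - (v k.castSucc).val := by
    intro k _
    have h1 := hv k
    rw [Fin.le_def] at h1
    split_ifs with h
    · have h2 : (v k.castSucc).val ≠ (v k.succ).val := fun h3 => h (Fin.ext h3)
      omega
    · omega
  have hcard : (∑ k : Fin m, if v k.castSucc ≠ v k.succ then 1 else 0 : ℤ) =
      (Finset.univ.filter fun k : Fin m => v k.castSucc ≠ v k.succ).card := by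
    rw [Finset.sum_boole]
  have hs := Finset.sum_le_sum hle
  rw [hcard, hsum] at hs
  have h0 := (v (Fin.last m)).2
  have hcN : (Finset.univ.filter fun k : Fin m => v k.castSucc ≠ v k.succ).card = N := by omega
  refine ⟨Fin.ext (by simp only [Fin.val_zero]; omega),
    Fin.ext (by simp only [Fin.val_last]; omega), ?_⟩
  -- A proper step climbs at least 1 and the total climb is at most `N`, so with `N` proper steps
  -- every inequality is an equality.
  have heq := (Finset.sum_eq_sum_iff_of_le hle).1 (by rw [hcard, hsum]; omega)
  have hstep : ∀ k : Fin m, v k.castSucc ≠ v k.succ → (v k.succ).val = (v k.castSucc).val + 1 :=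
    fun k hk => by
      have := heq k (Finset.mem_univ k)
      rw [if_pos hk] at this
      omega
  have hmono : Monotone v := Fin.monotone_iff_le_succ.2 hv
  let f : {k : Fin m // v k.castSucc ≠ v k.succ} → Fin N := fun k =>
    ⟨(v k.1.castSucc).val, by have := hstep k.1 k.2; have := (v k.1.succ).2; omega⟩
  have hlt : ∀ k k' : {k : Fin m // v k.castSucc ≠ v k.succ}, k.1 < k'.1 → f k < f k' :=
    fun k k' h => by
      have h1 : v k.1.succ ≤ v k'.1.castSucc := hmono (by
        rw [Fin.le_def, Fin.val_succ, Fin.val_castSucc]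
        exact h)
      have h2 := hstep k.1 k.2
      rw [Fin.le_def] at h1
      rw [Fin.lt_def]
      simp only [f]
      omega
  have hinj : Function.Injective f := fun k k' h => by
    rcases lt_trichotomy k.1 k'.1 with h1 | h1 | h1
    · exact absurd h (hlt _ _ h1).ne
    · exact Subtype.ext h1
    · exact absurd h (hlt _ _ h1).ne'
  have hbij : Function.Bijective f := by
    rw [Fintype.bijective_iff_injective_and_card, Fintype.card_subtype, Fintype.card_fin]
    exact ⟨hinj, hcN⟩
  let E := Equiv.ofBijective f hbij
  refine ⟨⟨fun e => (E.symm e).1, fun e e' h => E.symm.injective (Subtype.ext h)⟩,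
    fun e => ?_, fun k hk => ⟨E ⟨k, hk⟩, congrArg Subtype.val (E.symm_apply_apply ⟨k, hk⟩)⟩⟩
  have h1 : (v (E.symm e).1.castSucc).val = e.val :=
    congrArg Fin.val (show f (E.symm e) = e from E.apply_symm_apply e)
  exact ⟨Fin.ext h1, Fin.ext (by
    have := hstep _ (E.symm e).2
    change (v (E.symm e).1.succ).val = e.val + 1
    omega)⟩

/-- The span of the monomials with fewer than `N` off-diagonal factors. -/
def lowSpan (F : Type*) [Field F] (N m : ℕ) : Submodule F ((ℕ → UT F (N + 1)) → F) :=
  Submodule.span F (Set.range fun φ : LowIndex N m => mon F φ.1)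

/-- The span of the dominant monomials. -/
def mainSpan (F : Type*) [Field F] (N m : ℕ) : Submodule F ((ℕ → UT F (N + 1)) → F) :=
  Submodule.span F (Set.range fun t : MainIndex N m => mon F (coord ∘ t.label))

/-- Off-diagonal factors arise only at proper steps. If there are `N` of them, `exists_steps`
determines the path, and every proper step contributes `e` or `e.rev`. The conditional keeps
`mainSpan` to the corner entry, so that the main term is counted once and not for all `n ^ 2`
entries. -/
theorem path_mem_span (s : Equiv.Perm (Fin m)) (d : Fin m → Bool)
    (v : Fin (m + 1) → Fin (N + 1)) :
    (fun a : ℕ → UT F (N + 1) => ∏ k : Fin m, ent (v k.castSucc) (v k.succ)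
      (bif d k then σ.toLinearMap (a (s k)) else a (s k))) ∈
      lowSpan F N m ⊔ if v 0 = 0 ∧ v (Fin.last m) = Fin.last N then mainSpan F N m else ⊥ := by
  by_cases hv : ∀ k : Fin m, v k.castSucc ≤ v k.succ
  swap
  · push Not at hv
    obtain ⟨k, hk⟩ := hv
    convert Submodule.zero_mem _
    exact Finset.prod_eq_zero (Finset.mem_univ k) (ent_of_lt hk _)
  have h1 := prod_mem_span_mon (F := F)
    (fun i : Fin m => allowed (v (s.symm i).castSucc) (v (s.symm i).succ))
    (fun i => ent (v (s.symm i).castSucc) (v (s.symm i).succ) ∘ₗ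
      (bif d (s.symm i) then σ.toLinearMap else LinearMap.id))
    (fun i => ent_star_mem_span σ _ _ _)
  have h2 : (fun a : ℕ → UT F (N + 1) => ∏ k : Fin m, ent (v k.castSucc) (v k.succ)
      (bif d k then σ.toLinearMap (a (s k)) else a (s k))) =
      fun a => ∏ i : Fin m, (ent (v (s.symm i).castSucc) (v (s.symm i).succ) ∘ₗ
      (bif d (s.symm i) then σ.toLinearMap else LinearMap.id) : UT F (N + 1) →ₗ[F] F) (a i) := by
    ext a
    refine Eq.trans ?_ (Equiv.prod_comp s _)
    refine Finset.prod_congr rfl fun k _ => ?_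
    rw [s.symm_apply_apply]
    cases d k <;> rfl
  rw [h2]
  refine (Submodule.span_le.2 ?_) h1
  rintro _ ⟨φ, hφ, rfl⟩
  by_cases hlow : (Finset.univ.filter fun i => (φ i).1 ≠ (φ i).2).card < N
  · exact Submodule.mem_sup_left (Submodule.subset_span ⟨⟨φ, hlow⟩, rfl⟩)
  push Not at hlow
  have hsub : (Finset.univ.filter fun i => (φ i).1 ≠ (φ i).2) ⊆
      (Finset.univ.filter fun k : Fin m => v k.castSucc ≠ v k.succ).map s.toEmbedding := by
    intro i hi
    rw [Finset.mem_filter] at hi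
    rw [Finset.mem_map_equiv, Finset.mem_filter]
    exact ⟨Finset.mem_univ _, fun h => hi.2 ((hφ i).1 h)⟩
  have hcard := Finset.card_le_card hsub
  rw [Finset.card_map] at hcard
  obtain ⟨hv0, hvl, κ, hκ, hκ'⟩ := exists_steps v hv (hlow.trans hcard)
  have hcN : (Finset.univ.filter fun k : Fin m => v k.castSucc ≠ v k.succ).card ≤ N := by
    have : (Finset.univ.filter fun k : Fin m => v k.castSucc ≠ v k.succ) ⊆
        Finset.univ.map κ := fun k hk => by
      obtain ⟨e, he⟩ := hκ' k (Finset.mem_filter.1 hk).2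
      exact Finset.mem_map.2 ⟨e, Finset.mem_univ _, he⟩
    simpa using Finset.card_le_card this
  have hset := Finset.eq_of_subset_of_card_le hsub (by rw [Finset.card_map]; omega)
  have hnd : ∀ e, (φ (s (κ e))).1 ≠ (φ (s (κ e))).2 := fun e => by
    have : s (κ e) ∈ (Finset.univ.filter fun i => (φ i).1 ≠ (φ i).2) := by
      rw [hset, Finset.mem_map_equiv, Finset.mem_filter, s.symm_apply_apply, (hκ e).1, (hκ e).2]
      exact ⟨Finset.mem_univ _, e.castSucc_lt_succ.ne⟩
    exact (Finset.mem_filter.1 this).2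
  have hex : ∀ i, ∃ x, coord x = φ i ∧ ((∀ e, i = s (κ e) → x = Sum.inr e ∨ x = Sum.inr e.rev) ∧
      (i ∉ Set.range (κ.trans s.toEmbedding) → ∃ w, x = Sum.inl w)) := fun i => by
    by_cases hi : i ∈ Set.range (κ.trans s.toEmbedding)
    · obtain ⟨e, rfl⟩ := hi
      have h3 := hφ (s (κ e))
      simp only [Equiv.symm_apply_apply] at h3
      have huniq : ∀ e', κ.trans s.toEmbedding e = s (κ e') → e = e' := fun e' h =>
        κ.injective (s.injective h)
      rcases h3.2 e (hκ e).1 (hκ e).2 with h4 | h4 | h4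
      · exact absurd h4 (hnd e)
      · exact ⟨Sum.inr e, h4.symm, fun e' h => by rw [huniq e' h]; exact Or.inl rfl,
          fun h => absurd ⟨e, rfl⟩ h⟩
      · exact ⟨Sum.inr e.rev, h4.symm, fun e' h => by rw [huniq e' h]; exact Or.inr rfl,
          fun h => absurd ⟨e, rfl⟩ h⟩
    · refine ⟨Sum.inl (φ i).1, Prod.ext rfl ((hφ i).1 ?_), fun e h => absurd ⟨e, h.symm⟩ hi,
        fun _ => ⟨_, rfl⟩⟩
      by_contra h
      obtain ⟨e, he⟩ := hκ' _ h
      exact hi ⟨e, by simp [he]⟩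
  choose ψ hψ hψ1 hψ2 using hex
  obtain ⟨t, ht⟩ := MainIndex.exists_label_eq ψ (κ.trans s.toEmbedding)
    (fun e => hψ1 _ e rfl) hψ2
  rw [if_pos ⟨hv0, hvl⟩]
  refine Submodule.mem_sup_right (Submodule.subset_span ⟨t, ?_⟩)
  dsimp only
  rw [ht]
  congr 1
  exact funext hψ

theorem word_entry_mem_span (s : Equiv.Perm (Fin m)) (d : Fin m → Bool) (p q : Fin (N + 1)) :
    (fun a : ℕ → UT F (N + 1) => ent p q
      (starEval σ a (List.ofFn fun k : Fin m => starVar F (s k) (d k)).prod)) ∈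
      lowSpan F N m ⊔ if p = 0 ∧ q = Fin.last N then mainSpan F N m else ⊥ := by
  have h : (fun a : ℕ → UT F (N + 1) => ent p q
      (starEval σ a (List.ofFn fun k : Fin m => starVar F (s k) (d k)).prod)) =
      ∑ v : Fin (m + 1) → Fin (N + 1), if v 0 = p ∧ v (Fin.last m) = q then
        (fun a : ℕ → UT F (N + 1) => ∏ k : Fin m, ent (v k.castSucc) (v k.succ)
          (bif d k then σ.toLinearMap (a (s k)) else a (s k))) else 0 := by
    ext a
    rw [map_list_prod, List.map_ofFn, ent_prod_ofFn, Finset.sum_apply]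
    refine Finset.sum_congr rfl fun v _ => ?_
    split_ifs
    · exact Finset.prod_congr rfl fun k _ => by rw [Function.comp_apply, starEval_starVar]
    · rfl
  rw [h]
  refine Submodule.sum_mem _ fun v _ => ?_
  by_cases h1 : v 0 = p ∧ v (Fin.last m) = q
  · rw [if_pos h1]
    have h3 := path_mem_span σ s d v
    rwa [h1.1, h1.2] at h3
  · rw [if_neg h1]
    exact Submodule.zero_mem _

theorem starCodim_le (m : ℕ) : starCodim σ m ≤
    m.descFactorial N * (2 ^ (N / 2) * (N + 1) ^ (m - N)) +
      Fintype.card (LowIndex N m) * ((N + 1) * (N + 1)) := by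
  classical
  let T : Fin (N + 1) → Fin (N + 1) →
      ((ℕ → UT F (N + 1)) → F) →ₗ[F] ((ℕ → UT F (N + 1)) → UT F (N + 1)) := fun p q =>
    { toFun := fun g a => g a • unit F p q
      map_add' := fun g h => funext fun a => add_smul _ _ _
      map_smul' := fun c g => funext fun a => mul_smul _ _ _ }
  let fam : MainIndex N m ⊕ LowIndex N m × (Fin (N + 1) × Fin (N + 1)) →
      ((ℕ → UT F (N + 1)) → UT F (N + 1)) :=
    Sum.elim (fun t => T 0 (Fin.last N) (mon F (coord ∘ t.label)))
      fun x => T x.2.1 x.2.2 (mon F x.1.1)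
  have hlow : ∀ p q, (lowSpan F N m).map (T p q) ≤ Submodule.span F (Set.range fam) :=
    fun p q => by
      rw [lowSpan, Submodule.map_span, Submodule.span_le]
      rintro _ ⟨_, ⟨φ, rfl⟩, rfl⟩
      exact Submodule.subset_span ⟨Sum.inr (φ, (p, q)), rfl⟩
  have hmain : (mainSpan F N m).map (T 0 (Fin.last N)) ≤ Submodule.span F (Set.range fam) := by
    rw [mainSpan, Submodule.map_span, Submodule.span_le]
    rintro _ ⟨_, ⟨t, rfl⟩, rfl⟩
    exact Submodule.subset_span ⟨Sum.inl t, rfl⟩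
  have hle : (multilinearStar F m).map (starFun σ) ≤ Submodule.span F (Set.range fam) := by
    rw [multilinearStar, Submodule.map_span, Submodule.span_le]
    rintro _ ⟨_, ⟨⟨s, d⟩, rfl⟩, rfl⟩
    have h1 : starFun σ (List.ofFn fun k : Fin m => starVar F (s k) (d k)).prod =
        ∑ p, ∑ q, T p q (fun a => ent p q
          (starEval σ a (List.ofFn fun k : Fin m => starVar F (s k) (d k)).prod)) := by
      ext1 a
      simp only [Finset.sum_apply]
      exact eq_sum_unit _
    simp only [SetLike.mem_coe, h1]
    refine Submodule.sum_mem _ fun p _ => Submodule.sum_mem _ fun q _ => ?_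
    have h2 := Submodule.mem_map_of_mem (f := T p q) (word_entry_mem_span σ s d p q)
    rw [Submodule.map_sup] at h2
    refine sup_le (hlow p q) ?_ h2
    split_ifs with h3
    · rw [h3.1, h3.2]
      exact hmain
    · simp
  rw [starCodim_eq_finrank_map]
  have : Module.Finite F (Submodule.span F (Set.range fam)) :=
    FiniteDimensional.span_of_finite F (Set.finite_range fam)
  refine (Submodule.finrank_mono hle).trans ((finrank_range_le_card fam).trans_eq ?_)
  rw [Fintype.card_sum, card_mainIndex, Fintype.card_prod, Fintype.card_prod, Fintype.card_fin]

end UT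


/-! ### Multidegrees and iterated commutators. -/

/-- The span of all the words in which the letters `x_i` and `x_i∗` occur with the multiplicities
given by the multiset `S`. -/
def multihomogeneousStar (F : Type*) [Field F] (S : Multiset ℕ) : Submodule F (FreeStarAlg F) :=
  Submodule.span F ((fun L : List (ℕ × Bool) => (L.map fun x => starVar F x.1 x.2).prod) ''
    {L | ((L.map Prod.fst : List ℕ) : Multiset ℕ) = S})

namespace multihomogeneousStar

variable {F : Type*} [Field F]

theorem one_mem : (1 : FreeStarAlg F) ∈ multihomogeneousStar F 0 :=
  Submodule.subset_span ⟨[], rfl, rfl⟩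

theorem starVar_mem (i : ℕ) (d : Bool) : starVar F i d ∈ multihomogeneousStar F {i} :=
  Submodule.subset_span ⟨[(i, d)], rfl, by simp⟩

theorem mul_mem {S T : Multiset ℕ} {f g : FreeStarAlg F} (hf : f ∈ multihomogeneousStar F S)
    (hg : g ∈ multihomogeneousStar F T) : f * g ∈ multihomogeneousStar F (S + T) := by
  have h := Submodule.mul_mem_mul hf hg
  rw [multihomogeneousStar, multihomogeneousStar, Submodule.span_mul_span] at h
  refine Submodule.span_mono ?_ h
  rintro _ ⟨_, ⟨L, hL, rfl⟩, _, ⟨L', hL', rfl⟩, rfl⟩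
  refine ⟨L ++ L', ?_, by simp⟩
  simp only [Set.mem_ofPred_eq] at hL hL' ⊢
  rw [List.map_append, ← Multiset.coe_add, hL, hL']

theorem prod_map_mem (L : List ℕ) :
    (L.map fun i => starVar F i false).prod ∈ multihomogeneousStar F (L : Multiset ℕ) := by
  refine Submodule.subset_span ⟨L.map fun i => (i, false), ?_, ?_⟩
  · simp [Function.comp_def]
  · simp [Function.comp_def]

theorem prod_ofFn_mem {N : ℕ} {S : Fin N → Multiset ℕ} {C : Fin N → FreeStarAlg F}
    (h : ∀ e, C e ∈ multihomogeneousStar F (S e)) :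
    (List.ofFn C).prod ∈ multihomogeneousStar F (∑ e, S e) := by
  induction N with
  | zero => simpa using one_mem
  | succ N ih =>
    rw [List.ofFn_succ, List.prod_cons, Fin.sum_univ_succ]
    exact mul_mem (h 0) (ih fun e => h e.succ)

theorem range_le_multilinearStar (m : ℕ) :
    multihomogeneousStar F (Multiset.range m) ≤ multilinearStar F m := by
  refine Submodule.span_le.2 ?_
  rintro _ ⟨L, hL, rfl⟩
  simp only [Set.mem_ofPred_eq] at hL
  have hm : L.length = m := by
    have := congrArg Multiset.card hL
    simpa using this
  have hnd : (L.map Prod.fst).Nodup := by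
    have := Multiset.nodup_range m
    rw [← hL, Multiset.coe_nodup] at this
    exact this
  have hlt : ∀ x ∈ L, x.1 < m := fun x hx => by
    have : x.1 ∈ Multiset.range m := by
      rw [← hL, Multiset.mem_coe]
      exact List.mem_map_of_mem hx
    exact Multiset.mem_range.1 this
  subst hm
  let s : Fin L.length → Fin L.length := fun k => ⟨(L.get k).1, hlt _ (L.get_mem k)⟩
  have hs : Function.Injective s := fun k k' h => by
    have h1 : (L.get k).1 = (L.get k').1 := congrArg Fin.val h
    have h2 := hnd.injective_get
    have h3 := @h2 (k.cast (by simp)) (k'.cast (by simp)) (by simpa using h1)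
    exact Fin.ext (by simpa using congrArg Fin.val h3)
  refine Submodule.subset_span ⟨(Equiv.ofBijective s (Finite.injective_iff_bijective.1 hs),
    fun k => (L.get k).2), ?_⟩
  have h4 : (fun k : Fin L.length => starVar F (s k) (L.get k).2) =
      (fun x : ℕ × Bool => starVar F x.1 x.2) ∘ L.get := rfl
  simp only [Equiv.ofBijective_apply]
  rw [h4, ← List.map_ofFn, List.ofFn_get]

end multihomogeneousStar

/-- The iterated commutator `[…[[c, x_1], x_2], …]`. -/
def iterComm {A : Type*} [Ring A] (c : A) (L : List A) : A :=
  L.foldl (fun c x => c * x - x * c) c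

theorem iterComm_cons {A : Type*} [Ring A] (c x : A) (L : List A) :
    iterComm c (x :: L) = iterComm (c * x - x * c) L := rfl

theorem map_iterComm {A B : Type*} [Ring A] [Ring B] (f : A →+* B) (c : A) (L : List A) :
    f (iterComm c L) = iterComm (f c) (L.map f) := by
  induction L generalizing c with
  | nil => rfl
  | cons x L ih => rw [iterComm_cons, ih, List.map_cons, iterComm_cons, map_sub, map_mul, map_mul]

theorem multihomogeneousStar.iterComm_mem {F : Type*} [Field F] {S : Multiset ℕ}
    {c : FreeStarAlg F} (hc : c ∈ multihomogeneousStar F S) (L : List ℕ) :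
    iterComm c (L.map fun i => starVar F i false) ∈
      multihomogeneousStar F (S + (L : Multiset ℕ)) := by
  induction L generalizing c S with
  | nil => simpa [iterComm] using hc
  | cons i L ih =>
    rw [List.map_cons, iterComm_cons]
    have h : S + ((i :: L : List ℕ) : Multiset ℕ) = S + {i} + (L : Multiset ℕ) := by
      rw [← Multiset.cons_coe, ← Multiset.singleton_add, add_assoc]
    rw [h]
    refine ih (Submodule.sub_mem _ (mul_mem hc (starVar_mem i false)) ?_)
    rw [add_comm]
    exact mul_mem (starVar_mem i false) hc

/-! ### Detecting polynomials and their values. -/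

namespace UT

variable {F : Type*} [Field F] {N : ℕ}

/-- The functional `x ↦ x_{e+1,e+1} - x_{e,e}`. -/
def diagDiff (e : Fin N) : UT F (N + 1) →ₗ[F] F :=
  ent e.succ e.succ - ent e.castSucc e.castSucc

theorem diagDiff_apply (e : Fin N) (x : UT F (N + 1)) :
    diagDiff e x = ent e.succ e.succ x - ent e.castSucc e.castSucc x := rfl

theorem ent_diag_commutator (v : Fin (N + 1)) (x y : UT F (N + 1)) :
    ent v v (x * y - y * x) = 0 := by
  rw [map_sub, ent_diag_mul, ent_diag_mul, mul_comm, sub_self]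

theorem ent_superdiag_commutator (e : Fin N) (x y : UT F (N + 1)) :
    ent e.castSucc e.succ (x * y - y * x) =
      ent e.castSucc e.succ x * diagDiff e y - ent e.castSucc e.succ y * diagDiff e x := by
  rw [map_sub, ent_superdiag_mul, ent_superdiag_mul, diagDiff_apply, diagDiff_apply]
  ring

/-- For `c` with zero diagonal, commuting with `x` multiplies the entry at `e` by `diagDiff e x` and
leaves the diagonal zero. -/
theorem ent_superdiag_iterComm (e : Fin N) {c : UT F (N + 1)} (hc : ∀ v, ent v v c = 0)
    (L : List (UT F (N + 1))) :
    ent e.castSucc e.succ (iterComm c L) =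
      ent e.castSucc e.succ c * (L.map (diagDiff e)).prod := by
  induction L generalizing c with
  | nil => simp [iterComm]
  | cons x L ih =>
    rw [iterComm_cons, ih fun v => ent_diag_commutator v _ _, ent_superdiag_commutator,
      diagDiff_apply e c, hc, hc, List.map_cons, List.prod_cons]
    ring

theorem ent_diag_iterComm {c : UT F (N + 1)} (hc : ∀ v, ent v v c = 0)
    (L : List (UT F (N + 1))) (v : Fin (N + 1)) : ent v v (iterComm c L) = 0 := by
  induction L generalizing c with
  | nil => exact hc v
  | cons x L ih => exact ih fun v => ent_diag_commutator v _ _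

/-- `N` factors with zero diagonal must each climb by exactly one. -/
theorem ent_corner_mul_prod (z : UT F (N + 1)) (C : Fin N → UT F (N + 1))
    (hC : ∀ e v, ent v v (C e) = 0) :
    ent 0 (Fin.last N) (z * (List.ofFn C).prod) =
      ent 0 0 z * ∏ e, ent e.castSucc e.succ (C e) := by
  have hpath : ∀ v : Fin (N + 1) → Fin (N + 1), v ≠ id →
      ∏ k : Fin N, ent (v k.castSucc) (v k.succ) (C k) = 0 := fun v hv => by
    by_contra h
    replace h := Finset.prod_ne_zero_iff.1 h
    have hmono : StrictMono v := by
      rw [Fin.strictMono_iff_lt_succ]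
      intro k
      have hk := h k (Finset.mem_univ k)
      rcases lt_trichotomy (v k.castSucc) (v k.succ) with h1 | h1 | h1
      · exact h1
      · exact absurd (by rw [h1, hC]) hk
      · exact absurd (ent_of_lt h1 _) hk
    refine hv ((hmono.range_inj (g := id) strictMono_id).1 ?_)
    rw [Set.range_id]
    exact (Finite.injective_iff_surjective.1 hmono.injective).range_eq
  have hprod : ∀ p, ent p (Fin.last N) (List.ofFn C).prod =
      if p = 0 then ∏ e, ent e.castSucc e.succ (C e) else 0 := fun p => by
    rw [ent_prod_ofFn, Finset.sum_eq_single id]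
    · simp [eq_comm]
    · intro v _ hv
      rw [hpath v hv, ite_self]
    · simp
  rw [ent_mul]
  simp [hprod]

variable (σ : AlgInvolution F (UT F (N + 1)))

/-- The `∗`-polynomial which detects a dominant monomial. -/
def detector (F : Type*) [Field F] {N : ℕ} (T : Fin (N + 1) → List ℕ) (k t : Fin N → ℕ)
    (d : Fin N → Bool) : FreeStarAlg F :=
  ((T 0).map fun i => starVar F i false).prod *
    (List.ofFn fun e : Fin N => iterComm
      (starVar F (k e) (d e) * starVar F (t e) false - starVar F (t e) false * starVar F (k e) (d e))
      ((T e.succ).map fun i => starVar F i false)).prod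

theorem detector_mem (T : Fin (N + 1) → List ℕ) (k t : Fin N → ℕ) (d : Fin N → Bool) :
    detector F T k t d ∈ multihomogeneousStar F
      ((T 0 : Multiset ℕ) + ∑ e : Fin N, ({k e} + {t e} + (T e.succ : Multiset ℕ))) := by
  refine multihomogeneousStar.mul_mem (multihomogeneousStar.prod_map_mem _)
    (multihomogeneousStar.prod_ofFn_mem fun e => multihomogeneousStar.iterComm_mem
      (Submodule.sub_mem _ (multihomogeneousStar.mul_mem
        (multihomogeneousStar.starVar_mem _ _) (multihomogeneousStar.starVar_mem _ _)) ?_) _)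
  rw [add_comm]
  exact multihomogeneousStar.mul_mem
        (multihomogeneousStar.starVar_mem _ _) (multihomogeneousStar.starVar_mem _ _)

/-- The initial commutator with `t e` gives each factor a zero diagonal, even when the starred
letter has diagonal entries. -/
theorem ent_corner_detector (T : Fin (N + 1) → List ℕ) (k t : Fin N → ℕ) (d : Fin N → Bool)
    (a : ℕ → UT F (N + 1)) :
    ent 0 (Fin.last N) (starEval σ a (detector F T k t d)) =
      ((T 0).map fun i => ent 0 0 (a i)).prod * ∏ e : Fin N,
        ((ent e.castSucc e.succ (bif d e then σ.toLinearMap (a (k e)) else a (k e)) *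
            diagDiff e (a (t e)) - ent e.castSucc e.succ (a (t e)) *
            diagDiff e (bif d e then σ.toLinearMap (a (k e)) else a (k e))) *
          ((T e.succ).map fun i => diagDiff e (a i)).prod) := by
  have hlist : ∀ L : List ℕ, (L.map fun i => starVar F i false).map (starEval σ a) = L.map a :=
    fun L => by
      rw [List.map_map]
      exact List.map_congr_left fun i _ => starEval_starVar σ a i false
  have hcomm : ∀ e : Fin N, starEval σ a (iterComm (starVar F (k e) (d e) *
        starVar F (t e) false - starVar F (t e) false * starVar F (k e) (d e))
        ((T e.succ).map fun i => starVar F i false)) =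
      iterComm ((bif d e then σ.toLinearMap (a (k e)) else a (k e)) * a (t e) -
        a (t e) * (bif d e then σ.toLinearMap (a (k e)) else a (k e))) ((T e.succ).map a) :=
    fun e => by
      have h1 := map_iterComm (starEval σ a).toRingHom (starVar F (k e) (d e) *
        starVar F (t e) false - starVar F (t e) false * starVar F (k e) (d e))
        ((T e.succ).map fun i => starVar F i false)
      have h2 := hlist (T e.succ)
      simp only [AlgHom.toRingHom_eq_coe, RingHom.coe_coe] at h1
      rw [h1, h2, map_sub, map_mul, map_mul, starEval_starVar, starEval_starVar]
      rfl
  rw [detector, map_mul, map_list_prod, map_list_prod, hlist, List.map_ofFn,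
    ent_corner_mul_prod]
  · congr 1
    · have := map_list_prod (diagHom F (0 : Fin (N + 1))) ((T 0).map a)
      rw [List.map_map] at this
      exact this
    · refine Finset.prod_congr rfl fun e _ => ?_
      rw [Function.comp_apply, hcomm, ent_superdiag_iterComm e fun v => ent_diag_commutator v _ _,
        ent_superdiag_commutator, List.map_map]
      rfl
  · intro e v
    rw [Function.comp_apply, hcomm]
    exact ent_diag_iterComm (fun v => ent_diag_commutator v _ _) _ _

/-- The matrix which is substituted for a letter with a given label. -/
def labelMatrix (F : Type*) [Field F] {N : ℕ} : Fin (N + 1) ⊕ Fin N → UT F (N + 1) :=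
  Sum.elim (fun v => ∑ w, if v ≤ w then unit F w w else 0) fun e => unit F e.castSucc e.succ

theorem ent_labelMatrix_inl (v i j : Fin (N + 1)) :
    ent i j (labelMatrix F (Sum.inl v)) = if i = j ∧ v ≤ i then 1 else 0 := by
  have h : ∀ w : Fin (N + 1), ent i j (if v ≤ w then unit F w w else 0) =
      if w = i then (if i = j ∧ v ≤ i then 1 else 0) else 0 := fun w => by
    by_cases hw : w = i
    · subst hw
      by_cases hv : v ≤ w <;> simp [hv, ent_unit]
    · by_cases hv : v ≤ w <;> simp [hv, ent_unit, hw]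
  rw [labelMatrix, Sum.elim_inl, map_sum]
  simp [h]

theorem ent_labelMatrix_inr (e : Fin N) (i j : Fin (N + 1)) :
    ent i j (labelMatrix F (Sum.inr e)) = if e.castSucc = i ∧ e.succ = j then 1 else 0 :=
  ent_unit e.castSucc_lt_succ.le i j

theorem ent_zero_labelMatrix (x : Fin (N + 1) ⊕ Fin N) :
    ent 0 0 (labelMatrix F x) = if x = Sum.inl 0 then 1 else 0 := by
  rcases x with v | e
  · simp [ent_labelMatrix_inl]
  · rw [ent_labelMatrix_inr, if_neg, if_neg (by simp)]
    rintro ⟨-, h⟩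
    exact Fin.succ_ne_zero e h

/-- The matrices `∑_{w ≥ v} E_ww` are chosen to be dual to the entry `(0, 0)` and the functionals
`diagDiff e`. -/
theorem diagDiff_labelMatrix (e : Fin N) (x : Fin (N + 1) ⊕ Fin N) :
    diagDiff e (labelMatrix F x) = if x = Sum.inl e.succ then 1 else 0 := by
  rw [diagDiff_apply]
  rcases x with v | e'
  · rw [ent_labelMatrix_inl, ent_labelMatrix_inl]
    have h1 : (v ≤ e.castSucc) ↔ v.val ≤ e.val := Iff.rfl
    have h2 : (v ≤ e.succ) ↔ v.val ≤ e.val + 1 := Iff.rfl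
    have h3 : v = e.succ ↔ v.val = e.val + 1 := Fin.ext_iff
    simp only [true_and, h1, h2, Sum.inl.injEq, h3]
    split_ifs <;> first | omega | simp
  · have hne : ∀ v : Fin (N + 1), ¬ (e'.castSucc = v ∧ e'.succ = v) := by
      rintro v ⟨h1, h2⟩
      exact e'.castSucc_lt_succ.ne (h1.trans h2.symm)
    rw [ent_labelMatrix_inr, ent_labelMatrix_inr, if_neg (hne _), if_neg (hne _),
      if_neg (by simp), sub_zero]

theorem ent_superdiag_labelMatrix_inl (e : Fin N) (v : Fin (N + 1)) :
    ent e.castSucc e.succ (labelMatrix F (Sum.inl v)) = 0 := by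
  rw [ent_labelMatrix_inl, if_neg]
  exact fun h => e.castSucc_lt_succ.ne h.1

theorem ent_superdiag_labelMatrix_inr (e e' : Fin N) :
    ent e.castSucc e.succ (labelMatrix F (Sum.inr e')) = if e' = e then 1 else 0 := by
  rw [ent_labelMatrix_inr]
  simp

theorem ent_superdiag_star_labelMatrix (e e' : Fin N) :
    ent e.castSucc e.succ (σ.toLinearMap (labelMatrix F (Sum.inr e'))) ≠ 0 ↔ e' = e.rev := by
  obtain ⟨c, hc, l, hl⟩ := exists_involution_superdiag σ e
  rw [hl, ent_superdiag_labelMatrix_inr, Finset.sum_eq_zero]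
  · simp [hc]
  · intro v _
    rw [ent_labelMatrix_inr, if_neg, mul_zero]
    rintro ⟨h1, h2⟩
    exact e'.castSucc_lt_succ.ne (h1.trans h2.symm)

end UT

theorem linearIndependent_of_diagonal {F M ι : Type*} [Field F] [AddCommGroup M] [Module F M]
    (f : ι → M) (ψ : ι → M →ₗ[F] F) (h : ∀ i j, ψ j (f i) ≠ 0 ↔ i = j) :
    LinearIndependent F f := by
  rw [linearIndependent_iff']
  intro s g hg i hi
  have h1 := congrArg (ψ i) hg
  simp only [map_sum, map_smul, map_zero, smul_eq_mul] at h1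
  rw [Finset.sum_eq_single i] at h1
  · exact (mul_eq_zero.1 h1).resolve_right ((h i i).2 rfl)
  · intro j _ hj
    rw [not_not.1 (mt (h j i).1 hj), mul_zero]
  · exact fun h2 => absurd hi h2

/-! ### The lower bound: independence of the dominant labellings. -/

namespace UT

variable {F : Type*} [Field F] {N r m : ℕ} (σ : AlgInvolution F (UT F (N + 1)))

/-- The index set for the lower bound: surjective labellings of the first `r` letters by diagonal
positions, and dominant monomials in the remaining letters. -/
abbrev LowerIndex (N r m : ℕ) : Type :=
  {β : Fin r → Fin (N + 1) // Function.Surjective β} × MainIndex N m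

namespace LowerIndex

variable (x : LowerIndex N r m)

/-- The labels of all the letters. -/
def label : Fin r ⊕ Fin m → Fin (N + 1) ⊕ Fin N :=
  Sum.elim (fun i => Sum.inl (x.1.1 i)) x.2.label

/-- The letters with superdiagonal labels. -/
def special : Fin N ↪ Fin r ⊕ Fin m := x.2.1.trans Function.Embedding.inr

/-- A choice of letters with the labels `1, …, N` among the first ones. -/
def pivot : Fin N ↪ Fin r ⊕ Fin m :=
  ⟨fun e => Sum.inl (Function.surjInv x.1.2 e.succ), fun _ _ h =>
    Fin.succ_injective N (Function.injective_surjInv x.1.2 (Sum.inl_injective h))⟩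

theorem label_pivot (e : Fin N) : x.label (x.pivot e) = Sum.inl e.succ :=
  congrArg Sum.inl (Function.surjInv_eq x.1.2 e.succ)

theorem label_special (e : Fin N) : x.label (x.special e) = Sum.inr (x.2.target e) :=
  x.2.label_special e

open Classical in
/-- The letters which are neither special nor pivots and have the diagonal label `v`. -/
def zone (v : Fin (N + 1)) : Finset (Fin r ⊕ Fin m) :=
  (Finset.univ.map x.special ∪ Finset.univ.map x.pivot)ᶜ.filter fun y => x.label y = Sum.inl v

theorem exists_label_inl (y : Fin r ⊕ Fin m) (hy : y ∉ Set.range x.special) :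
    ∃ v, x.label y = Sum.inl v := by
  rcases y with i | j
  · exact ⟨_, rfl⟩
  · exact ⟨_, x.2.label_rest ⟨j, fun ⟨e, he⟩ => hy ⟨e, congrArg Sum.inr he⟩⟩⟩

theorem label_injective : Function.Injective (label : LowerIndex N r m → _) := by
  rintro ⟨β, t⟩ ⟨β', t'⟩ h
  refine Prod.ext (Subtype.ext (funext fun i => ?_)) (MainIndex.label_injective (funext fun j => ?_))
  · exact Sum.inl_injective (congrFun h (Sum.inl i))
  · exact congrFun h (Sum.inr j)

/-- Every letter is special, a pivot, or in exactly one zone. With singleton multisets as values,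
this says that the detector is multilinear. -/
theorem sum_letters {M : Type*} [AddCommMonoid M] (f : Fin r ⊕ Fin m → M) :
    (∑ y ∈ x.zone 0, f y) + ∑ e : Fin N,
      (f (x.special e) + f (x.pivot e) + ∑ y ∈ x.zone e.succ, f y) = ∑ y, f y := by
  classical
  have hdisj : Disjoint (Finset.univ.map x.special) (Finset.univ.map x.pivot) := by
    rw [Finset.disjoint_left]
    simp only [Finset.mem_map, Finset.mem_univ, true_and, not_exists]
    rintro _ ⟨e, rfl⟩ e' h
    exact Sum.inl_ne_inr h
  have hzone : ∑ v, ∑ y ∈ x.zone v, f y =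
      ∑ y ∈ (Finset.univ.map x.special ∪ Finset.univ.map x.pivot)ᶜ, f y := by
    simp only [zone, Finset.sum_filter]
    rw [Finset.sum_comm]
    refine Finset.sum_congr rfl fun y hy => ?_
    obtain ⟨v, hv⟩ := x.exists_label_inl y fun ⟨e, he⟩ => by
      simp only [Finset.mem_compl, Finset.mem_union, not_or] at hy
      exact hy.1 (Finset.mem_map.2 ⟨e, Finset.mem_univ _, he⟩)
    simp [hv]
  rw [← Finset.sum_compl_add_sum (Finset.univ.map x.special ∪ Finset.univ.map x.pivot) f, ← hzone,
    Finset.sum_union hdisj, Finset.sum_map, Finset.sum_map, Fin.sum_univ_succ,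
    Finset.sum_add_distrib, Finset.sum_add_distrib]
  abel

/-- The detecting `∗`-polynomial. -/
def poly (F : Type*) [Field F] : FreeStarAlg F :=
  detector F (fun v => (x.zone v).toList.map fun y => (finSumFinEquiv y).val)
    (fun e => (finSumFinEquiv (x.special e)).val) (fun e => (finSumFinEquiv (x.pivot e)).val)
    -- A letter labelled `e.rev` is starred, since `∗` moves its entry to position `e`.
    fun e => decide (x.2.target e ≠ e)

theorem poly_mem : x.poly F ∈ multilinearStar F (r + m) := by
  refine multihomogeneousStar.range_le_multilinearStar _ ?_
  have h := detector_mem (F := F)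
    (fun v => (x.zone v).toList.map fun y => (finSumFinEquiv y).val)
    (fun e => (finSumFinEquiv (x.special e)).val) (fun e => (finSumFinEquiv (x.pivot e)).val)
    fun e => decide (x.2.target e ≠ e)
  have hz : ∀ v, (((x.zone v).toList.map fun y => (finSumFinEquiv y).val : List ℕ) : Multiset ℕ) =
      ∑ y ∈ x.zone v, {(finSumFinEquiv y).val} := fun v => by
    rw [← Multiset.map_coe, Finset.coe_toList, Finset.sum_eq_multiset_sum,
      ← Multiset.sum_map_singleton (Multiset.map _ _), Multiset.map_map]
    rfl
  simp only [hz] at h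
  rw [x.sum_letters fun y => ({(finSumFinEquiv y).val} : Multiset ℕ),
    finSumFinEquiv.sum_comp fun i => ({i.val} : Multiset ℕ)] at h
  rw [Fin.sum_univ_eq_sum_range fun i => ({i} : Multiset ℕ), Finset.sum_multiset_singleton] at h
  exact h

/-- The substitution which belongs to the labels. -/
def subst (F : Type*) [Field F] (i : ℕ) : UT F (N + 1) :=
  if h : i < r + m then labelMatrix F (x.label (finSumFinEquiv.symm ⟨i, h⟩)) else 0

theorem subst_apply (y : Fin r ⊕ Fin m) :
    x.subst F (finSumFinEquiv y).val = labelMatrix F (x.label y) := by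
  rw [subst, dif_pos (finSumFinEquiv y).2, Fin.eta, Equiv.symm_apply_apply]

/-- The value is a product of tests, one for each letter, that its label under `x'` is the one
prescribed by `x`; hence the polynomials and substitutions are dual up to nonzero scalars. -/
theorem eval_poly_ne_zero_iff (x' : LowerIndex N r m) :
    ent 0 (Fin.last N) (starEval σ (x'.subst F) (x.poly F)) ≠ 0 ↔ x = x' := by
  have hval : ent 0 (Fin.last N) (starEval σ (x'.subst F) (x.poly F)) =
      (∏ y ∈ x.zone 0, if x'.label y = Sum.inl 0 then 1 else 0) * ∏ e : Fin N,
        (ent e.castSucc e.succ (bif decide (x.2.target e ≠ e) then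
            σ.toLinearMap (labelMatrix F (x'.label (x.special e)))
            else labelMatrix F (x'.label (x.special e))) *
          (if x'.label (x.pivot e) = Sum.inl e.succ then 1 else 0) *
          ∏ y ∈ x.zone e.succ, if x'.label y = Sum.inl e.succ then 1 else 0) := by
    -- Pivots lie among the reserved letters, which are diagonal under every `x'`; this kills the
    -- second term of the initial commutator.
    have hpiv : ∀ e : Fin N, ent e.castSucc e.succ (labelMatrix F (x'.label (x.pivot e))) = 0 :=
      fun e => ent_superdiag_labelMatrix_inl e _
    rw [poly, ent_corner_detector]
    simp only [subst_apply, List.map_map, Function.comp_def, Finset.prod_map_toList, hpiv,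
      diagDiff_labelMatrix, ent_zero_labelMatrix, zero_mul, sub_zero]
  rw [hval, mul_ne_zero_iff, Finset.prod_ne_zero_iff, Finset.prod_ne_zero_iff]
  simp only [mul_ne_zero_iff, Finset.prod_ne_zero_iff, ne_eq, ite_eq_right_iff, one_ne_zero,
    imp_false, not_not]
  constructor
  · rintro ⟨h0, h1⟩
    have hrest : ∀ y, y ∉ Set.range x.special → x'.label y = x.label y := fun y hy => by
      by_cases hp : y ∈ Set.range x.pivot
      · obtain ⟨e, rfl⟩ := hp
        rw [x.label_pivot]
        exact (h1 e (Finset.mem_univ e)).1.2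
      · obtain ⟨v, hv⟩ := x.exists_label_inl y hy
        have hz : y ∈ x.zone v := by
          simp only [zone, Finset.mem_filter, Finset.mem_compl, Finset.mem_union, Finset.mem_map,
            Finset.mem_univ, true_and]
          exact ⟨fun h => h.elim hy hp, hv⟩
        rw [hv]
        refine Fin.cases (fun hz => h0 y hz)
          (fun e hz => (h1 e (Finset.mem_univ e)).2 y hz) v hz
    -- Outside the special letters of `x` all labels are now known to be diagonal, so the special
    -- letters of `x'` lie among them, and there are `N` of each.
    have hsub : Finset.univ.map x'.special ⊆ Finset.univ.map x.special := by
      intro y hy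
      obtain ⟨e, -, rfl⟩ := Finset.mem_map.1 hy
      by_contra hne
      have hne' : x'.special e ∉ Set.range x.special := fun ⟨e', he'⟩ =>
        hne (Finset.mem_map.2 ⟨e', Finset.mem_univ _, he'⟩)
      obtain ⟨v, hv⟩ := x.exists_label_inl _ hne'
      have h2 := hrest _ hne'
      rw [x'.label_special, hv] at h2
      exact Sum.inr_ne_inl h2
    have hset := Finset.eq_of_subset_of_card_le hsub (by simp)
    refine label_injective (funext fun y => ?_)
    by_cases hy : y ∈ Set.range x.special
    · obtain ⟨e, rfl⟩ := hy
      have h2 := (h1 e (Finset.mem_univ e)).1.1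
      obtain ⟨e', -, he'⟩ := Finset.mem_map.1 (hset.symm ▸ Finset.mem_map_of_mem x.special
        (Finset.mem_univ e))
      rw [← he', x'.label_special] at h2
      rw [x.label_special, ← he', x'.label_special]
      by_cases ht : x.2.target e = e
      · simp only [ht, not_true_eq_false, decide_false, cond_false,
          ent_superdiag_labelMatrix_inr] at h2
        rw [ht]
        by_contra hne
        exact h2 (if_neg fun h => hne (congrArg Sum.inr h.symm))
      · simp only [ht, not_false_eq_true, decide_true, cond_true] at h2
        rw [(x.2.target_eq_or e).resolve_left ht, (ent_superdiag_star_labelMatrix σ e _).1 h2]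
    · exact (hrest y hy).symm
  · rintro rfl
    have hzone : ∀ v, ∀ y ∈ x.zone v, x.label y = Sum.inl v := fun v y hy =>
      (Finset.mem_filter.1 hy).2
    refine ⟨hzone 0, fun e _ => ⟨⟨?_, x.label_pivot e⟩, hzone e.succ⟩⟩
    rw [x.label_special]
    by_cases ht : x.2.target e = e
    · simp [ht, ent_superdiag_labelMatrix_inr]
    · simp only [ht, not_false_eq_true, decide_true, cond_true]
      exact (ent_superdiag_star_labelMatrix σ e _).2 ((x.2.target_eq_or e).resolve_left ht)

end LowerIndex

open Classical in
theorem le_starCodim (r m : ℕ) :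
    Fintype.card {β : Fin r → Fin (N + 1) // Function.Surjective β} *
      (m.descFactorial N * (2 ^ (N / 2) * (N + 1) ^ (m - N))) ≤ starCodim σ (r + m) := by
  have hli : LinearIndependent F fun x : LowerIndex N r m => starFun σ (x.poly F) :=
    linearIndependent_of_diagonal _
      (fun x' => ent 0 (Fin.last N) ∘ₗ LinearMap.proj (x'.subst F))
      fun x x' => x.eval_poly_ne_zero_iff σ x'
  have hfin : Module.Finite F ((multilinearStar F (r + m)).map (starFun σ)) := by
    rw [multilinearStar, Submodule.map_span]
    exact FiniteDimensional.span_of_finite F ((Set.finite_range _).image _)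
  rw [starCodim_eq_finrank_map, ← card_mainIndex, ← Fintype.card_prod, ← finrank_span_eq_card hli]
  refine Submodule.finrank_mono (Submodule.span_le.2 ?_)
  rintro _ ⟨x, rfl⟩
  exact Submodule.mem_map_of_mem x.poly_mem

end UT


/-! ### The asymptotics. -/

open Classical in
theorem pow_le_card_surjective_add (N r : ℕ) :
    (N + 1) ^ r ≤ Fintype.card {β : Fin r → Fin (N + 1) // Function.Surjective β} +
      (N + 1) * N ^ r := by
  have h1 : (Finset.univ.filter fun β : Fin r → Fin (N + 1) => ¬ Function.Surjective β) ⊆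
      Finset.univ.biUnion fun v : Fin (N + 1) =>
        Fintype.piFinset fun _ : Fin r => Finset.univ.erase v := by
    intro β hβ
    simp only [Finset.mem_filter, Function.Surjective, not_forall, not_exists] at hβ
    obtain ⟨-, v, hv⟩ := hβ
    exact Finset.mem_biUnion.2 ⟨v, Finset.mem_univ v, Fintype.mem_piFinset.2 fun i =>
      Finset.mem_erase.2 ⟨hv i, Finset.mem_univ _⟩⟩
  have h2 := (Finset.card_le_card h1).trans Finset.card_biUnion_le
  simp only [Fintype.card_piFinset, Finset.card_erase_of_mem (Finset.mem_univ _),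
    Finset.card_univ, Fintype.card_fin, Finset.prod_const, Finset.sum_const, smul_eq_mul,
    Nat.add_sub_cancel] at h2
  rw [Fintype.card_subtype]
  have h3 := Finset.card_filter_add_card_filter_not (s := Finset.univ)
    fun β : Fin r → Fin (N + 1) => Function.Surjective β
  rw [Finset.card_univ, Fintype.card_fun, Fintype.card_fin, Fintype.card_fin] at h3
  omega

namespace UT

variable {F : Type*} [Field F] {N : ℕ} (σ : AlgInvolution F (UT F (N + 1)))

/-- The asymptotic value of the `∗`-codimensions of `UT_{N+1}`. -/
def codimAsymp (N m : ℕ) : ℝ :=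
  (2 : ℝ) ^ (N / 2) / ((N + 1 : ℕ) : ℝ) ^ N * (m : ℝ) ^ N * ((N + 1 : ℕ) : ℝ) ^ m

/-- The exponent `3 * N + 2` collects `2 * N` from the count of low labellings, 2 from the matrix
entries, and `N` from the denominator of `codimAsymp`. -/
theorem starCodim_div_le {m : ℕ} (hm : N < m) :
    (starCodim σ m : ℝ) / codimAsymp N m ≤
      1 + ((N + 1 : ℕ) : ℝ) ^ (3 * N + 2) / 2 ^ (N / 2) / m := by
  have hm0 : (0 : ℝ) < m := by exact_mod_cast (Nat.zero_le N).trans_lt hm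
  have hD : 0 < codimAsymp N m := by
    unfold codimAsymp
    positivity
  rw [div_le_iff₀ hD]
  have h1 : (starCodim σ m : ℝ) ≤ m.descFactorial N * (2 ^ (N / 2) * ((N + 1 : ℕ) : ℝ) ^ (m - N)) +
      Fintype.card (LowIndex N m) * (((N + 1 : ℕ) : ℝ) * ((N + 1 : ℕ) : ℝ)) := by
    exact_mod_cast starCodim_le σ m
  have h2 : (Fintype.card (LowIndex N m) : ℝ) * m ≤
      (((N + 1 : ℕ) : ℝ) * ((N + 1 : ℕ) : ℝ)) ^ N * ((m : ℝ) ^ N * ((N + 1 : ℕ) : ℝ) ^ m) := by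
    exact_mod_cast card_lowIndex_mul_le N m
  have h3 : (m.descFactorial N : ℝ) ≤ (m : ℝ) ^ N := by
    exact_mod_cast Nat.descFactorial_le_pow m N
  generalize hq : ((N + 1 : ℕ) : ℝ) = q at *
  have hq0 : 0 < q := by rw [← hq]; positivity
  have hpow : q ^ m = q ^ (m - N) * q ^ N := by rw [← pow_add, Nat.sub_add_cancel hm.le]
  have h4 : codimAsymp N m = (m : ℝ) ^ N * (2 ^ (N / 2) * q ^ (m - N)) := by
    rw [codimAsymp, hq, hpow]
    field_simp
  have h5 : (Fintype.card (LowIndex N m) : ℝ) * (q * q) ≤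
      q ^ (3 * N + 2) / 2 ^ (N / 2) / m * codimAsymp N m := by
    have h6 : q ^ (3 * N + 2) / 2 ^ (N / 2) / m * codimAsymp N m =
        ((q * q) ^ N * ((m : ℝ) ^ N * q ^ m)) * (q * q) / m := by
      rw [codimAsymp, hq]
      field_simp
      ring
    rw [h6, le_div_iff₀ hm0]
    nlinarith [mul_le_mul_of_nonneg_right h2 (mul_pos hq0 hq0).le]
  rw [add_mul, one_mul]
  refine h1.trans (add_le_add ?_ h5)
  rw [h4]
  exact mul_le_mul_of_nonneg_right h3 (by positivity)

theorem le_starCodim_div {r m : ℕ} (hm : r + N < m) :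
    (1 - ((N + 1 : ℕ) : ℝ) * ((N : ℝ) / ((N + 1 : ℕ) : ℝ)) ^ r) *
      (((m : ℝ) - (r + N)) / m) ^ N ≤ (starCodim σ m : ℝ) / codimAsymp N m := by
  classical
  obtain ⟨k, rfl⟩ : ∃ k, m = r + k := ⟨m - r, by omega⟩
  have hk : N < k := by omega
  have hm0 : (0 : ℝ) < ((r + k : ℕ) : ℝ) := by exact_mod_cast (by omega : 0 < r + k)
  have hD : 0 < codimAsymp N (r + k) := by
    unfold codimAsymp
    positivity
  rw [le_div_iff₀ hD]
  have h1 : (Fintype.card {β : Fin r → Fin (N + 1) // Function.Surjective β} : ℝ) *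
      (k.descFactorial N * (2 ^ (N / 2) * ((N + 1 : ℕ) : ℝ) ^ (k - N))) ≤
        starCodim σ (r + k) := by
    exact_mod_cast le_starCodim σ r k
  have h2 : ((N + 1 : ℕ) : ℝ) ^ r ≤
      Fintype.card {β : Fin r → Fin (N + 1) // Function.Surjective β} +
        ((N + 1 : ℕ) : ℝ) * (N : ℝ) ^ r := by
    exact_mod_cast pow_le_card_surjective_add N r
  have h3 : ((k : ℝ) - N) ^ N ≤ k.descFactorial N := by
    have h4 : (k - N) ^ N ≤ k.descFactorial N :=
      (Nat.pow_le_pow_left (by omega) N).trans (Nat.pow_sub_le_descFactorial k N)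
    rw [← Nat.cast_sub hk.le]
    exact_mod_cast h4
  have h5 : (0 : ℝ) ≤ (k : ℝ) - N := sub_nonneg.2 (by exact_mod_cast hk.le)
  refine le_trans ?_ h1
  generalize hq : ((N + 1 : ℕ) : ℝ) = q at *
  have hq0 : 0 < q := by rw [← hq]; positivity
  have hpow : q ^ (r + k) = q ^ r * (q ^ (k - N) * q ^ N) := by
    rw [← pow_add q (k - N), Nat.sub_add_cancel hk.le, pow_add]
  have h6 : (1 - q * ((N : ℝ) / q) ^ r) * ((((r + k : ℕ) : ℝ) - (r + N)) / ((r + k : ℕ) : ℝ)) ^ N *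
      codimAsymp N (r + k) =
      (q ^ r - q * (N : ℝ) ^ r) * (((k : ℝ) - N) ^ N * (2 ^ (N / 2) * q ^ (k - N))) := by
    have h7 : (((r + k : ℕ) : ℝ) - (r + N)) = (k : ℝ) - N := by
      push_cast
      ring
    rw [codimAsymp, hq, hpow, h7, div_pow, div_pow]
    field_simp
  rw [h6]
  have h8 : (0 : ℝ) ≤ 2 ^ (N / 2) * q ^ (k - N) := by positivity
  exact mul_le_mul (by linarith) (mul_le_mul_of_nonneg_right h3 h8)
    (mul_nonneg (pow_nonneg h5 N) h8) (Nat.cast_nonneg _)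

theorem tendsto_starCodim_div :
    Tendsto (fun m : ℕ => (starCodim σ m : ℝ) / codimAsymp N m) atTop (𝓝 1) := by
  have hdiv : ∀ c : ℝ, Tendsto (fun m : ℕ => c / (m : ℝ)) atTop (𝓝 0) := fun c =>
    tendsto_const_nhds.div_atTop tendsto_natCast_atTop_atTop
  refine tendsto_order.2 ⟨fun a ha => ?_, fun a ha => ?_⟩
  · have hq : (N : ℝ) / ((N + 1 : ℕ) : ℝ) < 1 := by
      rw [div_lt_one (by positivity)]
      exact_mod_cast Nat.lt_succ_self N
    have h1 : Tendsto (fun r : ℕ => 1 - ((N + 1 : ℕ) : ℝ) * ((N : ℝ) / ((N + 1 : ℕ) : ℝ)) ^ r)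
        atTop (𝓝 1) := by
      simpa using ((tendsto_pow_atTop_nhds_zero_of_lt_one (by positivity) hq).const_mul
        ((N + 1 : ℕ) : ℝ)).const_sub 1
    -- Fix `r` first, so that the limit in `m` of the lower bound still exceeds `a`.
    obtain ⟨r, hr⟩ := (h1.eventually (lt_mem_nhds ha)).exists
    have h2 : Tendsto (fun m : ℕ => (1 - ((N + 1 : ℕ) : ℝ) * ((N : ℝ) / ((N + 1 : ℕ) : ℝ)) ^ r) *
        (1 - ((r : ℝ) + N) / m) ^ N) atTop
        (𝓝 (1 - ((N + 1 : ℕ) : ℝ) * ((N : ℝ) / ((N + 1 : ℕ) : ℝ)) ^ r)) := by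
      simpa using (((hdiv ((r : ℝ) + N)).const_sub 1).pow N).const_mul
        (1 - ((N + 1 : ℕ) : ℝ) * ((N : ℝ) / ((N + 1 : ℕ) : ℝ)) ^ r)
    filter_upwards [h2.eventually (lt_mem_nhds hr), eventually_gt_atTop (r + N)] with m hm hm'
    refine hm.trans_le ?_
    have hm0 : (m : ℝ) ≠ 0 := by exact_mod_cast (by omega : m ≠ 0)
    have h3 : 1 - ((r : ℝ) + N) / m = ((m : ℝ) - (r + N)) / m := by rw [sub_div, div_self hm0]
    rw [h3]
    exact le_starCodim_div σ hm'
  · have h1 := (hdiv (((N + 1 : ℕ) : ℝ) ^ (3 * N + 2) / 2 ^ (N / 2))).const_add 1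
    rw [add_zero] at h1
    filter_upwards [h1.eventually (gt_mem_nhds ha), eventually_gt_atTop N] with m hm hm'
    exact (starCodim_div_le σ hm').trans_lt hm

end UT

end

theorem mainTheorem3 (F : Type*) [Field F] [Infinite F] (n : ℕ) (hn : 1 ≤ n)
    (σ : AlgInvolution F (UT F n)) :
    Tendsto (fun m : ℕ => (starCodim σ m : ℝ) /
        ((2 : ℝ) ^ ((n - 1) / 2) / (n : ℝ) ^ (n - 1) * (m : ℝ) ^ (n - 1) * (n : ℝ) ^ m))
      atTop (𝓝 1) := by
  obtain ⟨N, rfl⟩ : ∃ N, n = N + 1 := ⟨n - 1, by omega⟩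
  exact UT.tendsto_starCodim_div σ
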